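/- For an even integer $k\ge 4$ let $E_k(z)=\frac12\sum_{(c,d)\in\mathbb Z^2,\ \gcd(c,d)=1}(cz+d)^{-k}$ ($z\in\mathbb H$) be the normalised Eisenstein series of weight $k$ for $\mathrm{SL}_2(\mathbb Z)$. For even integers $k,\ell\ge 4$ put $\Delta_{k,\ell}=E_kE_\ell-E_{k+\ell}$, and let $B_{k,\ell}$ be the number of distinct zeros $z=x+iy$ of $\Delta_{k,\ell}$ with $x=\frac12$ and $y>\frac{\sqrt3}{2}$. Then there is an absolute constant $L$ such that for all even integers $k\ge\ell\ge L$ the number $B_{k,\ell}$ is finite and $$B_{k,\ell}\ \ge\ \begin{cases}\lfloor \ell/6\rfloor-1, & \ell\equiv 2,4 \pmod 6,\\ \lfloor \ell/6\rfloor-2, & \ell\equiv 0\pmod 6.\end{cases}$$ -/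

import Mathlib

open UpperHalfPlane

noncomputable section

/-- The function `Δ_{k,ℓ} = E_k E_ℓ - E_{k+ℓ}` on the upper half-plane, where `E_k` is the
normalised level one Eisenstein series of weight `k`,
`E_k(z) = (1/2) ∑_{(c,d)=1} (cz+d)^{-k}`. -/
def eisensteinDelta {k l : ℕ} (hk : 3 ≤ k) (hl : 3 ≤ l) (z : ℍ) : ℂ :=
  ModularForm.E hk z * ModularForm.E hl z
    - ModularForm.E (k := k + l) (hk.trans (Nat.le_add_right k l)) z

/-- The set of zeros of `Δ_{k,ℓ}` on the side `x = 1/2`, `y > √3/2`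
of the standard fundamental domain. -/
def sideZeros {k l : ℕ} (hk : 3 ≤ k) (hl : 3 ≤ l) : Set ℍ :=
  {z : ℍ | z.re = 1 / 2 ∧ Real.sqrt 3 / 2 < z.im ∧ eisensteinDelta hk hl z = 0}

/-- `B_{k,ℓ}`, the number of (distinct) zeros of `Δ_{k,ℓ}` on the side `x = 1/2`, `y > √3/2`. -/
def sideZeroCount {k l : ℕ} (hk : 3 ≤ k) (hl : 3 ≤ l) : ℕ :=
  (sideZeros hk hl).ncard

end

/-!
# Zeros of `E_k E_ℓ - E_{k+ℓ}` on the line `Re z = 1/2`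

On the line `Re z = 1/2` all Eisenstein series of even weight are real, so zeros of `Δ = Δ_{k,ℓ}` can
be produced by sign changes. Let `z = 1/2 + i y` and `δ = arctan (1 / (2 y))`, so that
`1 / z = ρ exp (-i (π/2 - δ))` with `ρ = 2 sin δ`; the condition `y > √3 / 2` is `δ < π / 6`. The
sample points are `δ = π m / ℓ` with `1 ≤ m < ℓ / 6`, where `z ^ (-ℓ) = ε ρ ^ ℓ` is real of sign
`ε = (-1) ^ (ℓ / 2 + m)`. The claim `ε Re Δ > 0` at every sample point
(`EisensteinSide.exists_sign_mul_delta_pos`) gives one zero between any two neighbours, hence at least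
`(ℓ - 2) / 6 - 1` zeros.

Write `E_k = 1 + A_k`, where `A_k` is half the sum of `(c z + d) ^ (-k)` over coprime rows with
`c ≠ 0`; then `Δ = A_k + A_ℓ + A_k A_ℓ - A_{k+ℓ}`.

* For `y ≤ 2` only the rows `±(1, 0)`, `±(1, -1)` matter, the rest being exponentially small relative
  to them (`norm_E_sub_leading_le`). The leading part of `Δ` is `2 ε ρ ^ ℓ (1 + u (1 + ε ρ ^ ℓ))` with
  `u = Re z ^ (-(k - ℓ))`. It keeps its sign because `u ≥ -1/2`
  (`neg_half_le_two_cos_pow_mul_cos`) and `ρ ^ ℓ ≤ 1/4`, both resting on the inequality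
  `2 cos (π/3 + t) ≤ exp (-√3 t)`.

* For `y ≥ 2` many rows contribute to `A_ℓ`, but at a sample point they are aligned: with
  `n = c + 2 d` and `T = tan δ`, a row with `c = ±1` contributes `ε |c z + d| ^ (-ℓ) exp (i ψ)` with
  `ψ = ± ℓ (arctan (n T) - n δ) = O (ℓ |n T| ^ 3)` (`sign_mul_rowInv_pow`). So all rows with
  `|n T| ≤ ℓ ^ (-1/3)` contribute with the sign `ε`, and the other rows with `|n| ≥ 3`, like those
  with `|c| ≥ 2`, contribute less than the leading ones by a factor `exp (-C ℓ ^ (1/3))`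
  (`norm_rowInv_le_of_bad`). Hence `ε Re A_ℓ` is almost a quarter of the sum of the absolute values
  `|c z + d| ^ (-ℓ)`. Either `k = ℓ` and `A_k = A_ℓ`, or `k ≥ ℓ + 2` and `A_k` is at most
  `ρ ^ 2 / 2 ≤ 1/8` of that sum.

Finiteness of the zero set holds because `Δ` extends holomorphically to the disc `|q| < 1` in the
coordinate `q = exp (2 π i z)`, in which the half-line `x = 1/2`, `y > √3 / 2` is relatively compact.
-/

namespace EisensteinSide

/-! ### Real-variable estimates -/

lemma abs_arctan_sub_self_le (x : ℝ) : |Real.arctan x - x| ≤ |x| ^ 3 / 3 := by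
  have key : ∀ x : ℝ, 0 ≤ x → |Real.arctan x - x| ≤ |x| ^ 3 / 3 := by
    intro x hx
    have h1 : MonotoneOn (fun x : ℝ ↦ x - Real.arctan x) (Set.Ici 0) := by
      refine monotoneOn_of_hasDerivWithinAt_nonneg (f' := fun x ↦ 1 - 1 / (1 + x ^ 2))
        (convex_Ici 0) (by fun_prop)
        (fun x _ ↦ ((hasDerivAt_id x).sub (Real.hasDerivAt_arctan x)).hasDerivWithinAt) ?_
      intro x _
      rw [sub_nonneg, div_le_one (by positivity)]
      nlinarith [sq_nonneg x]
    have h2 : MonotoneOn (fun x : ℝ ↦ Real.arctan x - x + x ^ 3 / 3) (Set.Ici 0) := by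
      refine monotoneOn_of_hasDerivWithinAt_nonneg
        (f' := fun x ↦ 1 / (1 + x ^ 2) - 1 + 3 * x ^ 2 / 3) (convex_Ici 0) (by fun_prop)
        (fun x _ ↦ ?_) ?_
      · have h3 : HasDerivAt (fun x : ℝ ↦ x ^ 3) (3 * x ^ 2) x := by
          simpa using hasDerivAt_pow 3 x
        exact (((Real.hasDerivAt_arctan x).sub (hasDerivAt_id x)).add
          (h3.div_const 3)).hasDerivWithinAt
      · intro x _
        have : 1 / (1 + x ^ 2) - 1 + 3 * x ^ 2 / 3 = x ^ 4 / (1 + x ^ 2) := by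
          field_simp
          ring
        rw [this]
        positivity
    have e1 := h1 Set.self_mem_Ici hx hx
    have e2 := h2 Set.self_mem_Ici hx hx
    simp only [Real.arctan_zero] at e1 e2
    rw [abs_of_nonneg hx, abs_le]
    constructor
    · linarith
    · have : 0 ≤ x ^ 3 := by positivity
      linarith
  rcases le_total 0 x with hx | hx
  · exact key x hx
  · have := key (-x) (by linarith)
    rwa [Real.arctan_neg, abs_neg, show -Real.arctan x - -x = -(Real.arctan x - x) by ring,
      abs_neg] at this

/-- On `[π/3, π/2]` the function `2 cos` decays at least like its logarithmic tangent at `π/3`. -/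
lemma two_mul_cos_le_exp {t : ℝ} (h0 : 0 ≤ t) (h1 : t ≤ Real.pi / 6) :
    2 * Real.cos (Real.pi / 3 + t) ≤ Real.exp (-(√3 * t)) := by
  have hd : AntitoneOn (fun t : ℝ ↦ (Real.cos t - √3 * Real.sin t) * Real.exp (√3 * t))
      (Set.Icc 0 (Real.pi / 6)) := by
    refine antitoneOn_of_hasDerivWithinAt_nonpos (convex_Icc _ _) (by fun_prop)
      (f' := fun t ↦ (-Real.sin t - √3 * Real.cos t) * Real.exp (√3 * t)
        + (Real.cos t - √3 * Real.sin t) * (Real.exp (√3 * t) * √3)) (fun t _ ↦ ?_) ?_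
    · have he : HasDerivAt (fun t : ℝ ↦ Real.exp (√3 * t)) (Real.exp (√3 * t) * √3) t := by
        simpa using ((hasDerivAt_id t).const_mul (√3)).exp
      exact (((Real.hasDerivAt_cos t).sub ((Real.hasDerivAt_sin t).const_mul _)).mul
        he).hasDerivWithinAt
    · intro t ht
      rw [interior_Icc] at ht
      have hs : 0 ≤ Real.sin t :=
        Real.sin_nonneg_of_nonneg_of_le_pi ht.1.le (by linarith [ht.2, Real.pi_pos])
      have h3 : √3 * √3 = 3 := Real.mul_self_sqrt (by norm_num)
      have : (-Real.sin t - √3 * Real.cos t) * Real.exp (√3 * t)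
          + (Real.cos t - √3 * Real.sin t) * (Real.exp (√3 * t) * √3)
          = -(4 * Real.sin t * Real.exp (√3 * t)) := by
        linear_combination (-Real.sin t * Real.exp (√3 * t)) * h3
      rw [this, neg_nonpos]
      positivity
  have h := hd (Set.left_mem_Icc.2 (by positivity)) ⟨h0, h1⟩ h0
  simp only [Real.cos_zero, Real.sin_zero, mul_zero, Real.exp_zero, sub_zero, one_mul] at h
  rw [Real.cos_add, Real.cos_pi_div_three, Real.sin_pi_div_three, Real.exp_neg,
    ← one_div, le_div_iff₀ (Real.exp_pos _)]
  convert h using 1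
  ring

lemma neg_half_sub_le_cos_even_mul {a : ℕ} (ha : Even a) {t : ℝ} (ht : 0 ≤ t) :
    -(1 / 2) - √3 / 2 * (a * t) ≤ Real.cos (a * (Real.pi / 3 + t)) := by
  have h3 : √3 * √3 = 3 := Real.mul_self_sqrt (by norm_num)
  have h3' : 1 ≤ √3 := Real.one_le_sqrt.2 (by norm_num)
  set s : ℝ := a * t with hs
  have hs0 : 0 ≤ s := by positivity
  have hsin : |Real.sin s| ≤ s := (Real.abs_sin_le_abs).trans_eq (abs_of_nonneg hs0)
  obtain ⟨hs1, hs2⟩ := abs_le.1 hsin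
  have hc := Real.cos_le_one s
  obtain ⟨b, rfl⟩ := ha
  obtain ⟨c, hc3⟩ : ∃ c, b = 3 * c ∨ b = 3 * c + 1 ∨ b = 3 * c + 2 := ⟨b / 3, by omega⟩
  have e : ((b + b : ℕ) : ℝ) * (Real.pi / 3 + t) = b * (2 * (Real.pi / 3)) + s := by
    rw [hs]; push_cast; ring
  rw [e]
  have c2 : Real.cos (2 * (Real.pi / 3)) = -1 / 2 := by
    rw [Real.cos_two_mul, Real.cos_pi_div_three]; norm_num
  have s2 : Real.sin (2 * (Real.pi / 3)) = √3 / 2 := by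
    rw [Real.sin_two_mul, Real.cos_pi_div_three, Real.sin_pi_div_three]; ring
  rcases hc3 with rfl | rfl | rfl
  · rw [show ((3 * c : ℕ) : ℝ) * (2 * (Real.pi / 3)) + s = s + c * (2 * Real.pi) by
      push_cast; ring, Real.cos_add_nat_mul_two_pi]
    rcases le_total 1 s with h | h
    · nlinarith [Real.neg_one_le_cos s]
    · nlinarith [Real.one_sub_sq_div_two_le_cos (x := s)]
  · rw [show ((3 * c + 1 : ℕ) : ℝ) * (2 * (Real.pi / 3)) + s
      = 2 * (Real.pi / 3) + s + c * (2 * Real.pi) by push_cast; ring,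
      Real.cos_add_nat_mul_two_pi, Real.cos_add, c2, s2]
    nlinarith
  · rw [show ((3 * c + 2 : ℕ) : ℝ) * (2 * (Real.pi / 3)) + s
      = s - 2 * (Real.pi / 3) + (c + 1 : ℕ) * (2 * Real.pi) by push_cast; ring,
      Real.cos_add_nat_mul_two_pi, Real.cos_sub, c2, s2]
    nlinarith

/-- The interaction of the two leading terms: for even `a` the real part of `z ^ (-a)` on the line
`Re z = 1/2` above the corner is at least `-1/2`. -/
lemma neg_half_le_two_cos_pow_mul_cos {a : ℕ} (ha : Even a) {t : ℝ} (h0 : 0 ≤ t)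
    (h1 : t ≤ Real.pi / 6) :
    -(1 / 2) ≤ (2 * Real.cos (Real.pi / 3 + t)) ^ a * Real.cos (a * (Real.pi / 3 + t)) := by
  have hpos : 0 ≤ 2 * Real.cos (Real.pi / 3 + t) := by
    have := Real.cos_nonneg_of_neg_pi_div_two_le_of_le (x := Real.pi / 3 + t)
      (by linarith [Real.pi_pos]) (by linarith [Real.pi_pos])
    linarith
  rcases le_total 0 (Real.cos (a * (Real.pi / 3 + t))) with hc | hc
  · have := mul_nonneg (pow_nonneg hpos a) hc
    linarith
  · have e1 : (2 * Real.cos (Real.pi / 3 + t)) ^ a ≤ Real.exp (-(√3 * (a * t))) := by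
      refine (pow_le_pow_left₀ hpos (two_mul_cos_le_exp h0 h1) a).trans_eq ?_
      rw [← Real.exp_nat_mul]
      congr 1
      ring
    have e2 := neg_half_sub_le_cos_even_mul ha h0
    have e3 : (√3 * (a * t) + 1) * Real.exp (-(√3 * (a * t))) ≤ 1 := by
      rw [Real.exp_neg, ← div_eq_mul_inv, div_le_one (Real.exp_pos _)]
      exact Real.add_one_le_exp _
    have e4 := mul_le_mul_of_nonpos_right e1 hc
    have e5 := mul_le_mul_of_nonneg_left e2 (Real.exp_pos (-(√3 * (a * t)))).le
    nlinarith

lemma two_cos_pow_le_quarter {l : ℕ} {t : ℝ} (h0 : 0 ≤ t) (h1 : t ≤ Real.pi / 6)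
    (hl : Real.pi / 3 ≤ l * t) : (2 * Real.cos (Real.pi / 3 + t)) ^ l ≤ 1 / 4 := by
  have hpos : 0 ≤ 2 * Real.cos (Real.pi / 3 + t) := by
    have := Real.cos_nonneg_of_neg_pi_div_two_le_of_le (x := Real.pi / 3 + t)
      (by linarith [Real.pi_pos]) (by linarith [Real.pi_pos])
    linarith
  have e1 : (2 * Real.cos (Real.pi / 3 + t)) ^ l ≤ Real.exp (-(√3 * (l * t))) := by
    refine (pow_le_pow_left₀ hpos (two_mul_cos_le_exp h0 h1) l).trans_eq ?_
    rw [← Real.exp_nat_mul]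
    congr 1
    ring
  refine e1.trans ?_
  have h3 : (1.7 : ℝ) ≤ √3 := Real.le_sqrt_of_sq_le (by norm_num)
  have hu : (1.7 : ℝ) ≤ √3 * (l * t) := by nlinarith [Real.pi_gt_three]
  have hq := Real.quadratic_le_exp_of_nonneg (x := √3 * (l * t)) (by linarith)
  rw [Real.exp_neg, ← one_div]
  exact one_div_le_one_div_of_le (by norm_num) (by nlinarith)

/-- With `x = l ^ (1/3)`, the factor `exp (-1 / (6 x²)) ^ (l - 4)` gained on every discarded term
beats any fixed multiple of `l ^ 4`. -/
lemma exists_forall_pow_mul_exp_le (K : ℝ) (hK : 0 ≤ K) :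
    ∃ L : ℕ, 8 ≤ L ∧ ∀ l : ℕ, L ≤ l → ∃ x : ℝ, 2 ≤ x ∧ x ^ 3 = l ∧
      Real.exp (-(1 / (6 * x ^ 2))) ^ (l - 4) * (l ^ 4 * K) ≤ 1 / 100 := by
  have h1 := (Real.tendsto_pow_mul_exp_neg_atTop_nhds_zero 12).const_mul (12 ^ 12 * K)
  rw [mul_zero] at h1
  have h2 : Filter.Tendsto (fun l : ℕ ↦ (l : ℝ) ^ (1 / 3 : ℝ) / 12) Filter.atTop Filter.atTop :=
    ((tendsto_rpow_atTop (by norm_num)).comp tendsto_natCast_atTop_atTop).atTop_div_const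
      (by norm_num)
  have h3 := (h1.comp h2).eventually (eventually_le_nhds (show (0 : ℝ) < 1 / 100 by norm_num))
  obtain ⟨L, hL⟩ := Filter.eventually_atTop.1 h3
  refine ⟨max L 8, le_max_right _ _, fun l hl ↦ ?_⟩
  have hl8 : 8 ≤ l := (le_max_right _ _).trans hl
  have hl8' : (8 : ℝ) ≤ l := by exact_mod_cast hl8
  have hb := hL l ((le_max_left _ _).trans hl)
  simp only [Function.comp] at hb
  set x : ℝ := (l : ℝ) ^ (1 / 3 : ℝ) with hx
  have hx3 : x ^ 3 = l := by
    rw [hx, ← Real.rpow_natCast, ← Real.rpow_mul (by positivity)]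
    norm_num
  have hx0 : 0 ≤ x := by positivity
  have hx2 : 2 ≤ x := by
    by_contra h
    push Not at h
    have : x ^ 3 < 2 ^ 3 := pow_lt_pow_left₀ h hx0 (by norm_num)
    linarith
  refine ⟨x, hx2, hx3, le_trans ?_ hb⟩
  have e : Real.exp (-(1 / (6 * x ^ 2))) ^ (l - 4) ≤ Real.exp (-(x / 12)) := by
    rw [← Real.exp_nat_mul, Real.exp_le_exp, Nat.cast_sub (by omega), ← hx3, mul_neg, neg_le_neg_iff,
      mul_one_div, le_div_iff₀ (by positivity)]
    push_cast
    nlinarith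
  have e2 : (l : ℝ) ^ 4 = 12 ^ 12 * (x / 12) ^ 12 := by rw [← hx3]; ring
  rw [e2]
  calc _ ≤ Real.exp (-(x / 12)) * (12 ^ 12 * (x / 12) ^ 12 * K) := by gcongr
    _ = _ := by ring

/-! ### Eisenstein series as sums over coprime rows -/

/-- The coprime integer rows `(c, d)` with `c ≠ 0`. -/
def lowerRows : Set (Fin 2 → ℤ) := {v | IsCoprime (v 0) (v 1) ∧ v 0 ≠ 0}

/-- The inverse `(c z + d)⁻¹` attached to the row `v = (c, d)`. -/
noncomputable def rowInv (z : ℍ) (v : Fin 2 → ℤ) : ℂ := ((v 0 : ℂ) * z + v 1)⁻¹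

lemma norm_rowInv_pow_le {z : ℍ} (hre : z.re = 1 / 2) (him : √3 / 2 ≤ z.im) (k : ℕ)
    (v : Fin 2 → ℤ) :
    ‖rowInv z v‖ ^ k ≤
      EisensteinSeries.r ⟨⟨1 / 2, √3 / 2⟩, by positivity⟩ ^ (-(k : ℝ)) * ‖v‖ ^ (-(k : ℝ)) := by
  have hz : z ∈ UpperHalfPlane.verticalStrip (1 / 2) (√3 / 2) := by
    refine ⟨?_, him⟩
    rw [hre, abs_of_pos (by norm_num)]
  have := EisensteinSeries.summand_bound_of_mem_verticalStrip (k := k) (by positivity) v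
    (by positivity) hz
  rwa [Real.rpow_neg (norm_nonneg _), Real.rpow_natCast, ← inv_pow, ← norm_inv] at this

lemma summable_norm_rowInv_pow (z : ℍ) {k : ℕ} (hk : 3 ≤ k) :
    Summable fun v : Fin 2 → ℤ ↦ ‖rowInv z v‖ ^ k := by
  have h2 : (2 : ℝ) < k := by exact_mod_cast hk
  refine Summable.of_nonneg_of_le (fun v ↦ by positivity) (fun v ↦ ?_)
    ((EisensteinSeries.summable_one_div_norm_rpow h2).mul_left (EisensteinSeries.r z ^ (-(k : ℝ))))
  have := EisensteinSeries.summand_bound z (k := k) (by positivity) v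
  rwa [Real.rpow_neg (norm_nonneg _), Real.rpow_natCast, ← inv_pow, ← norm_inv] at this

lemma summable_rowInv_pow (z : ℍ) {k : ℕ} (hk : 3 ≤ k) :
    Summable fun v : Fin 2 → ℤ ↦ rowInv z v ^ k :=
  Summable.of_norm (by simpa only [norm_pow] using summable_norm_rowInv_pow z hk)

lemma exists_tsum_norm_rowInv_pow_four_le :
    ∃ K : ℝ, 0 ≤ K ∧ ∀ z : ℍ, z.re = 1 / 2 → √3 / 2 ≤ z.im →
      ∑' v : Fin 2 → ℤ, ‖rowInv z v‖ ^ 4 ≤ K := by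
  refine ⟨∑' v : Fin 2 → ℤ, EisensteinSeries.r ⟨⟨1 / 2, √3 / 2⟩, by positivity⟩ ^ (-((4 : ℕ) : ℝ))
      * ‖v‖ ^ (-((4 : ℕ) : ℝ)), tsum_nonneg fun v ↦ ?_, fun z hre him ↦ ?_⟩
  · have := EisensteinSeries.r_pos ⟨⟨1 / 2, √3 / 2⟩, by positivity⟩
    positivity
  · exact (summable_norm_rowInv_pow z (by norm_num)).tsum_le_tsum
      (norm_rowInv_pow_le hre him 4)
      ((EisensteinSeries.summable_one_div_norm_rpow (by norm_num)).mul_left _)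

/-- For even `k` the rows `(0, ±1)` contribute the constant term `1` of `E_k`. -/
lemma E_eq_one_add {k : ℕ} (hk : 3 ≤ k) (hk2 : Even k) (z : ℍ) :
    ModularForm.E hk z = 1 + (1 / 2) * ∑' v : lowerRows, rowInv z v ^ k := by
  have h0 : ModularForm.E hk z
      = (1 / 2 : ℂ) * ∑' v : EisensteinSeries.gammaSet 1 1 0, rowInv z v ^ k := by
    change (1 / 2 : ℂ) * ∑' v : EisensteinSeries.gammaSet 1 1 0, EisensteinSeries.eisSummand k v z
      = _
    congr 1
    refine tsum_congr fun v ↦ ?_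
    rw [EisensteinSeries.eisSummand, rowInv, zpow_neg, zpow_natCast, inv_pow]
  set t : Finset (Fin 2 → ℤ) := {![0, 1], ![0, -1]} with ht
  have hset : EisensteinSeries.gammaSet 1 1 0 = lowerRows ∪ (t : Set (Fin 2 → ℤ)) := by
    ext v
    rw [EisensteinSeries.mem_gammaSet_one]
    simp only [lowerRows, ht, Set.mem_union, Set.mem_ofPred_eq, Finset.coe_insert,
      Finset.coe_singleton, Set.mem_insert_iff, Set.mem_singleton_iff]
    constructor
    · intro h
      by_cases hv : v 0 = 0
      · rw [hv, isCoprime_zero_left, Int.isUnit_iff] at h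
        right
        rcases h with h | h
        · left
          ext i
          fin_cases i <;> simp [hv, h]
        · right
          ext i
          fin_cases i <;> simp [hv, h]
      · exact Or.inl ⟨h, hv⟩
    · rintro (h | rfl | rfl)
      · exact h.1
      · simp [isCoprime_zero_left]
      · simp [isCoprime_zero_left]
  have hdisj : Disjoint lowerRows (t : Set (Fin 2 → ℤ)) := by
    rw [Set.disjoint_left]
    rintro v ⟨_, hv⟩ hvt
    simp only [ht, Finset.coe_insert, Finset.coe_singleton, Set.mem_insert_iff,
      Set.mem_singleton_iff] at hvt
    rcases hvt with rfl | rfl <;> simp at hv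
  have hs := summable_rowInv_pow z hk
  have hne : (![0, 1] : Fin 2 → ℤ) ≠ ![0, -1] := fun h ↦ by
    have := congrFun h 1
    simp at this
  have hsum : ∑' v : (t : Set (Fin 2 → ℤ)), rowInv z v ^ k = 2 := by
    rw [Finset.tsum_subtype' t (fun v ↦ rowInv z v ^ k), ht, Finset.sum_pair hne]
    simp [rowInv, hk2.neg_pow]
    norm_num
  rw [h0, hset, Summable.tsum_union_disjoint (f := fun v ↦ rowInv z v ^ k) hdisj (hs.subtype _)
    (hs.subtype _), hsum]
  ring

/-- On the line `Re z = 1/2` complex conjugation permutes the rows by `(c, d) ↦ (-c, c + d)`. -/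
lemma conj_E_eq {k : ℕ} (hk : 3 ≤ k) (hk2 : Even k) {z : ℍ} (hre : z.re = 1 / 2) :
    (starRingEnd ℂ) (ModularForm.E hk z) = ModularForm.E hk z := by
  have hmem : ∀ v ∈ lowerRows, (![-v 0, v 0 + v 1] : Fin 2 → ℤ) ∈ lowerRows := by
    rintro v ⟨h1, h2⟩
    refine ⟨?_, by simpa using h2⟩
    simpa using IsCoprime.neg_left (by simpa [add_comm] using h1.add_mul_left_right 1)
  have hinv : ∀ v : Fin 2 → ℤ, ![-(-v 0), -v 0 + (v 0 + v 1)] = v := by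
    intro v
    ext i
    fin_cases i <;> simp
  let e : lowerRows ≃ lowerRows :=
    { toFun := fun v ↦ ⟨_, hmem v v.2⟩
      invFun := fun v ↦ ⟨_, hmem v v.2⟩
      left_inv := fun v ↦ Subtype.ext (by simpa using hinv v)
      right_inv := fun v ↦ Subtype.ext (by simpa using hinv v) }
  have hz : (starRingEnd ℂ) (z : ℂ) = 1 - z := by
    apply Complex.ext
    · simp only [Complex.conj_re, Complex.sub_re, Complex.one_re, coe_re, hre]
      norm_num
    · simp
  rw [E_eq_one_add hk hk2]
  simp only [map_add, map_mul, map_one, Complex.conj_tsum, map_pow]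
  rw [← e.tsum_eq]
  congr 2
  · simp [map_ofNat]
  · refine tsum_congr fun v ↦ ?_
    congr 1
    simp only [e, rowInv, Equiv.coe_fn_mk, map_inv₀, map_add, map_mul, hz, map_intCast]
    simp
    ring

/-! ### Size and argument of the terms on the line `Re z = 1/2` -/

lemma norm_rowInv_sq {z : ℍ} {T : ℝ} (hT : 0 < T) (hre : z.re = 1 / 2) (him : z.im = 1 / (2 * T))
    (v : Fin 2 → ℤ) :
    ‖rowInv z v‖ ^ 2 = 4 * T ^ 2 / ((v 0 : ℝ) ^ 2 + ((v 0 : ℝ) + 2 * v 1) ^ 2 * T ^ 2) := by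
  rw [rowInv, norm_inv, inv_pow, ← Complex.normSq_eq_norm_sq, Complex.normSq_apply]
  have e1 : ((v 0 : ℂ) * z + v 1).re = v 0 / 2 + v 1 := by
    simp [hre]; ring
  have e2 : ((v 0 : ℂ) * z + v 1).im = v 0 / (2 * T) := by
    simp [him]; ring
  rw [e1, e2, inv_eq_one_div]
  have h : ((v 0 : ℝ) / 2 + v 1) * (v 0 / 2 + v 1) + v 0 / (2 * T) * (v 0 / (2 * T))
      = ((v 0 : ℝ) ^ 2 + ((v 0 : ℝ) + 2 * v 1) ^ 2 * T ^ 2) / (4 * T ^ 2) := by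
    field_simp
    ring
  rw [h, one_div_div]

lemma rowInv_eq_mul_exp {z : ℍ} {T : ℝ} (hT : 0 < T) (hre : z.re = 1 / 2)
    (him : z.im = 1 / (2 * T)) {v : Fin 2 → ℤ} (hv : v 0 = 1 ∨ v 0 = -1) :
    rowInv z v = -Complex.I * v 0 * ‖rowInv z v‖ *
      Complex.exp (Real.arctan ((v 0 * (v 0 + 2 * v 1) : ℤ) * T) * Complex.I) := by
  set n : ℤ := v 0 * (v 0 + 2 * v 1) with hn
  set α := Real.arctan (n * T) with hα
  have hv2 : (v 0 : ℝ) ^ 2 = 1 := by rcases hv with h | h <;> simp [h]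
  have hn2 : ((v 0 : ℝ) + 2 * v 1) ^ 2 = (n : ℝ) ^ 2 := by
    rw [hn]; push_cast; rw [mul_pow, hv2, one_mul]
  have hcos : 0 < Real.cos α := Real.cos_arctan_pos _
  have hnorm : ‖rowInv z v‖ = 2 * T * Real.cos α := by
    rw [← pow_left_inj₀ (norm_nonneg _) (by positivity) (two_ne_zero),
      norm_rowInv_sq hT hre him, hv2, hn2, mul_pow, Real.cos_sq_arctan]
    ring
  have hzc : (z : ℂ) = 1 / 2 + 1 / (2 * T) * Complex.I := by
    apply Complex.ext
    · simp [hre]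
    · simp [him]
  have htan : Real.sin α = n * T * Real.cos α := by
    rw [← Real.tan_arctan (n * T), ← hα, Real.tan_mul_cos hcos.ne']
  have hTc : (T : ℂ) ≠ 0 := by exact_mod_cast hT.ne'
  have hcc : (Real.cos α : ℂ) ≠ 0 := by exact_mod_cast hcos.ne'
  have hs2 : (Real.sin α : ℂ) = n * T * Real.cos α := by exact_mod_cast htan
  have h1 : (Real.cos α : ℂ) ^ 2 + (Real.sin α : ℂ) ^ 2 = 1 := by
    exact_mod_cast Real.cos_sq_add_sin_sq α
  rw [hnorm, rowInv]
  refine inv_eq_of_mul_eq_one_right ?_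
  rw [Complex.exp_mul_I, ← Complex.ofReal_cos, ← Complex.ofReal_sin, hzc]
  have hI := Complex.I_sq
  have hvv : (v 0 : ℂ) ^ 2 = 1 := by exact_mod_cast hv2
  have hnc : (n : ℂ) = v 0 * (v 0 + 2 * v 1) := by rw [hn]; push_cast; ring
  have e : (v 0 : ℂ) * (1 / 2 + 1 / (2 * T) * Complex.I) + v 1
      = Complex.I * v 0 / (2 * T) * (1 - n * T * Complex.I) := by
    field_simp
    rw [hnc]
    linear_combination (-(T : ℂ) * (v 0 + 2 * v 1)) * hvv + T * (v 0) ^ 2 * (v 0 + 2 * v 1) * hI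
  rw [hs2] at h1
  rw [e, hs2]
  simp only [Complex.ofReal_mul, Complex.ofReal_ofNat]
  field_simp
  generalize (Real.cos α : ℂ) = C at *
  linear_combination (-Complex.I ^ 2 * C ^ 2 * (1 - n ^ 2 * T ^ 2 * Complex.I ^ 2)) * hvv
    + (-C ^ 2 * (1 - n ^ 2 * T ^ 2 * Complex.I ^ 2) - C ^ 2 * n ^ 2 * T ^ 2) * hI + h1

/-- At the point with `arctan (1 / (2 y)) = π m / l` the `l`-th powers of all terms with `c = ±1`
have, up to the common sign, a phase that vanishes to third order. -/
lemma sign_mul_rowInv_pow {z : ℍ} {T δ : ℝ} {l m : ℕ} (hl : Even l) (hT : 0 < T)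
    (hδ : l * δ = Real.pi * m) (hre : z.re = 1 / 2)
    (him : z.im = 1 / (2 * T)) {v : Fin 2 → ℤ} (hv : v 0 = 1 ∨ v 0 = -1) :
    (-1 : ℂ) ^ (l / 2 + m) * rowInv z v ^ l = (‖rowInv z v‖ ^ l : ℝ) *
      Complex.exp ((l * (Real.arctan ((v 0 * (v 0 + 2 * v 1) : ℤ) * T)
        - (v 0 * (v 0 + 2 * v 1) : ℤ) * δ) : ℝ) * Complex.I) := by
  set n : ℤ := v 0 * (v 0 + 2 * v 1) with hn
  have hodd : Odd n := by
    rcases hv with h | h <;> rw [hn, h] <;> [exact ⟨v 1, by ring⟩; exact ⟨-v 1, by ring⟩]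
  obtain ⟨j, rfl⟩ := hl
  obtain ⟨i, hi⟩ := hodd
  have hvl : ((v 0 : ℂ)) ^ (j + j) = 1 := by
    rcases hv with h | h <;> simp [h, ← two_mul, pow_mul]
  have hIl : (-Complex.I) ^ (j + j) = (-1) ^ j := by
    rw [← two_mul, pow_mul]
    simp
  have hexp : Complex.exp ((n : ℂ) * ((Real.pi * m : ℝ) : ℂ) * Complex.I) = (-1) ^ m := by
    rw [show (n : ℂ) * ((Real.pi * m : ℝ) : ℂ) * Complex.I
      = (m : ℂ) * (Real.pi * Complex.I) + ((i * m : ℤ) : ℂ) * (2 * Real.pi * Complex.I) by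
        rw [hi]; push_cast; ring, Complex.exp_add, Complex.exp_int_mul_two_pi_mul_I, mul_one,
      Complex.exp_nat_mul, Complex.exp_pi_mul_I]
  rw [rowInv_eq_mul_exp hT hre him hv, ← hn]
  rw [mul_pow, mul_pow, mul_pow, hvl, hIl, ← Complex.exp_nat_mul]
  have e : ((j + j : ℕ) : ℂ) * (Real.arctan (n * T) * Complex.I)
      = (((j + j : ℕ) * (Real.arctan (n * T) - n * δ) : ℝ) : ℂ) * Complex.I
        + (n : ℂ) * ((Real.pi * m : ℝ) : ℂ) * Complex.I := by
    rw [← hδ]; push_cast; ring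
  rw [e, Complex.exp_add, hexp, show (j + j) / 2 = j by omega, pow_add]
  have hj : ((-1 : ℂ) ^ j) * (-1) ^ j = 1 := by rw [← mul_pow]; simp
  have hm : ((-1 : ℂ) ^ m) * (-1) ^ m = 1 := by rw [← mul_pow]; simp
  have hnn : ‖-Complex.I * (v 0 : ℂ) * (‖rowInv z v‖ : ℂ)
      * Complex.exp (Real.arctan (n * T) * Complex.I)‖ = ‖rowInv z v‖ := by
    rw [norm_mul, Complex.norm_exp_ofReal_mul_I, norm_mul, norm_mul]
    rcases hv with h | h <;> simp [h]
  rw [hnn]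
  push_cast
  set A := Complex.exp (((j : ℂ) + j) * (Complex.arctan (n * T) - n * δ) * Complex.I)
  linear_combination ((‖rowInv z v‖ : ℂ) ^ (j + j) * A) * (hm + (-1) ^ m * (-1) ^ m * hj)

/-- The exactly aligned rows: those with `|c + 2 d| = 1`. -/
lemma sign_mul_rowInv_pow_of_near {z : ℍ} {T δ : ℝ} {l m : ℕ} (hl : Even l) (hT : 0 < T)
    (hδ : l * δ = Real.pi * m) (hTδ : Real.arctan T = δ) (hre : z.re = 1 / 2)
    (him : z.im = 1 / (2 * T)) {v : Fin 2 → ℤ} (hv : v 0 = 1 ∨ v 0 = -1)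
    (hn : v 0 * (v 0 + 2 * v 1) = 1 ∨ v 0 * (v 0 + 2 * v 1) = -1) :
    (-1 : ℂ) ^ (l / 2 + m) * rowInv z v ^ l = (‖rowInv z v‖ ^ l : ℝ) := by
  rw [sign_mul_rowInv_pow hl hT hδ hre him hv]
  rcases hn with h | h <;> rw [h] <;> simp [Real.arctan_neg, ← hTδ]

/-- The approximately aligned rows: the phase stays below `1` while `|c + 2 d| T ≤ l ^ (-1/3)`. -/
lemma half_norm_le_sign_mul_re_of_good {z : ℍ} {T δ x : ℝ} {l m : ℕ} (hl : Even l) (hT : 0 < T)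
    (hδ : l * δ = Real.pi * m) (hTδ : Real.arctan T = δ) (hre : z.re = 1 / 2)
    (him : z.im = 1 / (2 * T)) {v : Fin 2 → ℤ} (hv : v 0 = 1 ∨ v 0 = -1)
    (hx : 0 < x) (hxl : x ^ 3 = l) (hn : |(v 0 * (v 0 + 2 * v 1) : ℤ) * T| ≤ 1 / x) :
    1 / 2 * ‖rowInv z v‖ ^ l ≤ ((-1 : ℂ) ^ (l / 2 + m) * rowInv z v ^ l).re := by
  rw [sign_mul_rowInv_pow hl hT hδ hre him hv, Complex.re_ofReal_mul, Complex.exp_ofReal_mul_I_re]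
  have hn0 : v 0 * (v 0 + 2 * v 1) ≠ 0 := by
    rcases hv with h | h <;> rw [h] <;> omega
  set n : ℤ := v 0 * (v 0 + 2 * v 1)
  have h1 := abs_arctan_sub_self_le (n * T)
  have h2 := abs_arctan_sub_self_le T
  have hn1 : (1 : ℝ) ≤ |(n : ℝ)| := by exact_mod_cast Int.one_le_abs hn0
  rw [hTδ, abs_of_pos hT] at h2
  have h3 : |Real.arctan (n * T) - n * δ| ≤ 2 / 3 * |n * T| ^ 3 := by
    have e : Real.arctan (n * T) - n * δ = (Real.arctan (n * T) - n * T) - n * (δ - T) := by ring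
    have h4 : |(n : ℝ) * (δ - T)| ≤ |(n : ℝ) * T| ^ 3 / 3 := by
      rw [abs_mul, abs_mul, abs_of_pos hT, mul_pow]
      have : |(n : ℝ)| ≤ |(n : ℝ)| ^ 3 := le_self_pow₀ hn1 (by norm_num)
      calc |(n : ℝ)| * |δ - T| ≤ |(n : ℝ)| ^ 3 * (T ^ 3 / 3) := by gcongr
        _ = _ := by ring
    rw [e]
    linarith [abs_sub (Real.arctan (n * T) - n * T) (n * (δ - T))]
  have h5 : |(n : ℝ) * T| ^ 3 ≤ (1 / x) ^ 3 := by gcongr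
  have h6 : |l * (Real.arctan (n * T) - n * δ)| ≤ 1 := by
    rw [abs_mul, Nat.abs_cast, ← hxl]
    calc x ^ 3 * |Real.arctan (n * T) - n * δ| ≤ x ^ 3 * (2 / 3 * (1 / x) ^ 3) := by
          gcongr
          exact h3.trans (by gcongr)
      _ = 2 / 3 := by field_simp
      _ ≤ 1 := by norm_num
  have h7 := Real.one_sub_sq_div_two_le_cos (x := l * (Real.arctan (n * T) - n * δ))
  have h8 : (l * (Real.arctan (n * T) - n * δ)) ^ 2 ≤ 1 := by
    rw [← sq_abs]
    exact pow_le_one₀ (abs_nonneg _) h6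
  have : 0 ≤ ‖rowInv z v‖ ^ l := by positivity
  nlinarith

/-- The remaining rows are smaller than the leading one by a fixed factor. -/
lemma norm_rowInv_le_of_bad {z : ℍ} {T x : ℝ} (hT : 0 < T) (hT3 : T ^ 2 ≤ 1 / 3)
    (hre : z.re = 1 / 2) (him : z.im = 1 / (2 * T)) {v : Fin 2 → ℤ} (hv : v ∈ lowerRows)
    (hx : 2 ≤ x)
    (h : ¬ (v 0 = 1 ∨ v 0 = -1) ∨ (3 ≤ |v 0 * (v 0 + 2 * v 1)| ∧
      1 / x ≤ |(v 0 * (v 0 + 2 * v 1) : ℤ) * T|)) :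
    ‖rowInv z v‖ ≤ Real.exp (-(1 / (6 * x ^ 2))) * ‖rowInv z ![1, 0]‖ := by
  rw [← pow_le_pow_iff_left₀ (norm_nonneg _) (by positivity) two_ne_zero, mul_pow,
    norm_rowInv_sq hT hre him, norm_rowInv_sq hT hre him, ← Real.exp_nat_mul]
  have hb : 1 - 1 / (3 * x ^ 2) ≤ Real.exp ((2 : ℕ) * -(1 / (6 * x ^ 2))) := by
    have := Real.add_one_le_exp ((2 : ℕ) * -(1 / (6 * x ^ 2)))
    refine le_trans (le_of_eq ?_) this
    field_simp
    push_cast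
    ring
  refine le_trans ?_ (mul_le_mul_of_nonneg_right hb (by positivity))
  have hv0 : (v 0 : ℝ) ≠ 0 := by exact_mod_cast hv.2
  have hc : 0 < (v 0 : ℝ) ^ 2 := by positivity
  have hu0 : 0 ≤ ((v 0 : ℝ) + 2 * v 1) ^ 2 * T ^ 2 := by positivity
  simp only [Matrix.cons_val_zero, Matrix.cons_val_one, Int.cast_one, Int.cast_zero, mul_zero,
    add_zero, one_pow, one_mul]
  suffices H : 1 + T ^ 2 ≤
      (1 - 1 / (3 * x ^ 2)) * ((v 0 : ℝ) ^ 2 + ((v 0 : ℝ) + 2 * v 1) ^ 2 * T ^ 2) by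
    rw [← mul_div_assoc, div_le_div_iff₀ (by positivity) (by positivity)]
    calc _ = 4 * T ^ 2 * (1 + T ^ 2) := by ring
      _ ≤ 4 * T ^ 2 * ((1 - 1 / (3 * x ^ 2)) *
        ((v 0 : ℝ) ^ 2 + ((v 0 : ℝ) + 2 * v 1) ^ 2 * T ^ 2)) := by gcongr
      _ = _ := by ring
  set p : ℝ := 1 / x ^ 2 with hp
  have hp4 : p ≤ 1 / 4 := by
    rw [hp]
    exact one_div_le_one_div_of_le (by norm_num) (by nlinarith)
  have hp0 : 0 < p := by positivity
  have e3 : 1 / (3 * x ^ 2) = p / 3 := by rw [hp]; field_simp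
  rw [e3]
  by_cases hv1 : v 0 = 1 ∨ v 0 = -1
  · obtain ⟨hn3, hnx⟩ := h.resolve_left (not_not.2 hv1)
    have hv2 : (v 0 : ℝ) ^ 2 = 1 := by rcases hv1 with h | h <;> simp [h]
    have hn9 : (9 : ℝ) ≤ ((v 0 : ℝ) + 2 * v 1) ^ 2 := by
      have : (3 : ℤ) ^ 2 ≤ (v 0 * (v 0 + 2 * v 1)) ^ 2 := by
        rw [← sq_abs (v 0 * (v 0 + 2 * v 1))]
        gcongr
      have : (3 : ℝ) ^ 2 ≤ ((v 0 : ℝ) * (v 0 + 2 * v 1)) ^ 2 := by exact_mod_cast this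
      rw [mul_pow, hv2] at this
      linarith
    have hu : p ≤ ((v 0 : ℝ) + 2 * v 1) ^ 2 * T ^ 2 := by
      have : (1 / x) ^ 2 ≤ |((v 0 * (v 0 + 2 * v 1) : ℤ) : ℝ) * T| ^ 2 := by gcongr
      rw [sq_abs] at this
      push_cast at this
      rw [mul_pow, mul_pow, hv2] at this
      rw [hp]
      calc 1 / x ^ 2 = (1 / x) ^ 2 := by ring
        _ ≤ _ := this
        _ = _ := by ring
    have hT9 : 9 * T ^ 2 ≤ ((v 0 : ℝ) + 2 * v 1) ^ 2 * T ^ 2 := by gcongr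
    rw [hv2]
    nlinarith
  · have h4 : (4 : ℝ) ≤ (v 0 : ℝ) ^ 2 := by
      have : (2 : ℤ) ≤ |v 0| := by
        have := hv.2
        by_contra hlt
        push Not at hlt
        rcases abs_lt.1 hlt with ⟨h1, h2⟩
        omega
      have : (2 : ℤ) ^ 2 ≤ v 0 ^ 2 := by
        rw [← sq_abs (v 0)]
        gcongr
      have : (2 : ℝ) ^ 2 ≤ (v 0 : ℝ) ^ 2 := by exact_mod_cast this
      linarith
    nlinarith

/-! ### The sign of `Δ` at the sample points -/

/-- The point `z = 1/2 + i y` with `arctan (1 / (2 y)) = δ = π m / l`, at which `z ^ (-l)` is real;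
`T = tan δ`. For even `l` the condition `6 m + 2 ≤ l` says `δ < π / 6`, that is `y > √3 / 2`. -/
structure IsSamplePoint (z : ℍ) (l m : ℕ) (T δ : ℝ) : Prop where
  even : Even l
  one_le : 1 ≤ m
  lt : 6 * m + 2 ≤ l
  mul_eq : l * δ = Real.pi * m
  tan_eq : T = Real.tan δ
  re_eq : z.re = 1 / 2
  im_eq : z.im = 1 / (2 * T)

namespace IsSamplePoint

variable {z : ℍ} {l m : ℕ} {T δ : ℝ}

lemma delta_pos (h : IsSamplePoint z l m T δ) : 0 < δ := by
  have h1 : (1 : ℝ) ≤ m := by exact_mod_cast h.one_le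
  have h2 : 0 < (l : ℝ) := by have := h.lt; exact_mod_cast (by omega : 0 < l)
  have h3 := h.mul_eq
  have h4 : 0 < Real.pi * m := by positivity
  rw [← h3] at h4
  exact pos_of_mul_pos_right h4 h2.le

lemma mul_sub_ge (h : IsSamplePoint z l m T δ) : Real.pi / 3 ≤ l * (Real.pi / 6 - δ) := by
  have h1 : (6 * m + 2 : ℝ) ≤ l := by exact_mod_cast h.lt
  rw [mul_sub, h.mul_eq]
  nlinarith [Real.pi_pos]

lemma delta_lt (h : IsSamplePoint z l m T δ) : δ < Real.pi / 6 := by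
  have h1 := h.mul_sub_ge
  have h2 : 0 < (l : ℝ) * (Real.pi / 6 - δ) := lt_of_lt_of_le (by positivity) h1
  have := pos_of_mul_pos_right h2 (by positivity)
  linarith

lemma T_pos (h : IsSamplePoint z l m T δ) : 0 < T := by
  rw [h.tan_eq]
  exact Real.tan_pos_of_pos_of_lt_pi_div_two h.delta_pos (by linarith [h.delta_lt, Real.pi_pos])

lemma arctan_eq (h : IsSamplePoint z l m T δ) : Real.arctan T = δ := by
  rw [h.tan_eq]
  exact Real.arctan_tan (by linarith [h.delta_pos, Real.pi_pos])
    (by linarith [h.delta_lt, Real.pi_pos])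

lemma T_sq_lt (h : IsSamplePoint z l m T δ) : T ^ 2 < 1 / 3 := by
  have h1 : T < (√3)⁻¹ := by
    rw [← Real.arctan_lt_arctan_iff, h.arctan_eq, Real.arctan_inv_sqrt_three]
    exact h.delta_lt
  have h2 := pow_lt_pow_left₀ h1 h.T_pos.le two_ne_zero
  rwa [inv_pow, Real.sq_sqrt (by norm_num), inv_eq_one_div] at h2

lemma sqrt_three_div_two_lt_im (h : IsSamplePoint z l m T δ) : √3 / 2 < z.im := by
  have hT := h.T_pos
  rw [h.im_eq, lt_div_iff₀ (by positivity)]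
  have h1 : (√3 * T) ^ 2 < 1 := by
    rw [mul_pow, Real.sq_sqrt (by norm_num)]
    linarith [h.T_sq_lt]
  have := (sq_lt_one_iff₀ (by positivity)).1 h1
  linarith

lemma norm_leading (h : IsSamplePoint z l m T δ) :
    ‖rowInv z ![1, 0]‖ = 2 * Real.cos (Real.pi / 3 + (Real.pi / 6 - δ)) := by
  have hc : Real.cos (Real.pi / 3 + (Real.pi / 6 - δ)) = Real.sin δ := by
    rw [← Real.cos_pi_div_two_sub]; ring_nf
  have hs : 0 ≤ Real.sin δ := Real.sin_nonneg_of_nonneg_of_le_pi h.delta_pos.le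
    (by linarith [h.delta_lt, Real.pi_pos])
  rw [hc, ← pow_left_inj₀ (norm_nonneg _) (by positivity) two_ne_zero,
    norm_rowInv_sq h.T_pos h.re_eq h.im_eq, mul_pow, ← h.arctan_eq, Real.sin_sq_arctan]
  simp only [Matrix.cons_val_zero, Matrix.cons_val_one, Int.cast_one, Int.cast_zero]
  ring

lemma leading_eq (h : IsSamplePoint z l m T δ) : rowInv z ![1, 0] = ‖rowInv z ![1, 0]‖ *
    Complex.exp ((-(Real.pi / 3 + (Real.pi / 6 - δ)) : ℝ) * Complex.I) := by
  have h1 := rowInv_eq_mul_exp h.T_pos h.re_eq h.im_eq (v := ![1, 0]) (by simp)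
  have h2 : Complex.exp ((-(Real.pi / 3 + (Real.pi / 6 - δ)) : ℝ) * Complex.I)
      = -Complex.I * Complex.exp (δ * Complex.I) := by
    rw [← Complex.exp_neg_pi_div_two_mul_I, ← Complex.exp_add]
    congr 1
    push_cast
    ring
  rw [h2]
  refine h1.trans ?_
  simp only [Matrix.cons_val_zero, Matrix.cons_val_one, Int.cast_one, mul_zero,
    add_zero, mul_one, one_mul, h.arctan_eq]
  ring

lemma neg_half_le_re_leading_pow (h : IsSamplePoint z l m T δ) {a : ℕ} (ha : Even a) :
    -(1 / 2) ≤ (rowInv z ![1, 0] ^ a).re := by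
  rw [h.leading_eq, mul_pow, ← Complex.exp_nat_mul, ← Complex.ofReal_pow, ← mul_assoc,
    ← Complex.ofReal_natCast, ← Complex.ofReal_mul, Complex.re_ofReal_mul,
    Complex.exp_ofReal_mul_I_re, mul_neg, Real.cos_neg, h.norm_leading]
  exact neg_half_le_two_cos_pow_mul_cos ha (by linarith [h.delta_lt]) (by linarith [h.delta_pos])

lemma norm_leading_pow_le_quarter (h : IsSamplePoint z l m T δ) :
    ‖rowInv z ![1, 0]‖ ^ l ≤ 1 / 4 := by
  rw [h.norm_leading]
  exact two_cos_pow_le_quarter (by linarith [h.delta_lt]) (by linarith [h.delta_pos]) h.mul_sub_ge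

lemma one_le_mul_norm_leading (h : IsSamplePoint z l m T δ) :
    1 ≤ l * ‖rowInv z ![1, 0]‖ := by
  rw [h.norm_leading, show Real.pi / 3 + (Real.pi / 6 - δ) = Real.pi / 2 - δ by ring,
    Real.cos_pi_div_two_sub]
  have h1 := Real.mul_le_sin h.delta_pos.le (by linarith [h.delta_lt, Real.pi_pos])
  have h2 : (l : ℝ) * (2 / Real.pi * δ) = 2 * m := by
    rw [mul_left_comm, h.mul_eq]
    field_simp
  have h3 : (l : ℝ) * (2 / Real.pi * δ) ≤ l * Real.sin δ := by gcongr
  have h4 : (1 : ℝ) ≤ m := by exact_mod_cast h.one_le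
  linarith

lemma norm_leading_pos (h : IsSamplePoint z l m T δ) : 0 < ‖rowInv z ![1, 0]‖ := by
  have h1 := h.one_le_mul_norm_leading
  exact pos_of_mul_pos_right (lt_of_lt_of_le one_pos h1) (by positivity)

lemma norm_leading_sq (h : IsSamplePoint z l m T δ) :
    ‖rowInv z ![1, 0]‖ ^ 2 = 4 * T ^ 2 / (1 + T ^ 2) := by
  rw [norm_rowInv_sq h.T_pos h.re_eq h.im_eq]
  simp

lemma norm_leading_le_one (h : IsSamplePoint z l m T δ) : ‖rowInv z ![1, 0]‖ ≤ 1 := by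
  rw [← sq_le_one_iff₀ (norm_nonneg _), h.norm_leading_sq, div_le_one (by positivity)]
  linarith [h.T_sq_lt]

lemma norm_rowInv_le (h : IsSamplePoint z l m T δ) {v : Fin 2 → ℤ} (hv : v ∈ lowerRows) :
    ‖rowInv z v‖ ≤ ‖rowInv z ![1, 0]‖ := by
  rw [← pow_le_pow_iff_left₀ (norm_nonneg _) (norm_nonneg _) two_ne_zero, h.norm_leading_sq,
    norm_rowInv_sq h.T_pos h.re_eq h.im_eq]
  refine div_le_div_of_nonneg_left (by positivity) (by positivity) ?_
  have hT := h.T_sq_lt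
  have hc : (1 : ℤ) ≤ v 0 ^ 2 := by
    have := hv.2
    have : 0 < v 0 ^ 2 := by positivity
    omega
  by_cases h2 : v 0 ^ 2 = 1
  · have h3 : (v 0 : ℝ) ^ 2 = 1 := by exact_mod_cast h2
    have hn : (1 : ℤ) ≤ (v 0 + 2 * v 1) ^ 2 := by
      have : v 0 + 2 * v 1 ≠ 0 := by
        rcases Int.isUnit_iff.1 ((isUnit_pow_iff two_ne_zero).1 (h2 ▸ isUnit_one)) with h | h <;>
          rw [h] <;> omega
      have : 0 < (v 0 + 2 * v 1) ^ 2 := by positivity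
      omega
    have hn : (1 : ℝ) ≤ ((v 0 : ℝ) + 2 * v 1) ^ 2 := by exact_mod_cast hn
    nlinarith [sq_nonneg T]
  · have h4 : (2 : ℤ) ≤ v 0 ^ 2 := by omega
    have h4 : (2 : ℝ) ≤ (v 0 : ℝ) ^ 2 := by exact_mod_cast h4
    have : 0 ≤ ((v 0 : ℝ) + 2 * v 1) ^ 2 * T ^ 2 := by positivity
    linarith

/-- A fourth power is set aside to keep the sum over all rows convergent. -/
lemma norm_rowInv_pow_le_of_bad (h : IsSamplePoint z l m T δ) {b : ℝ} (hb0 : 0 ≤ b) (hb1 : b ≤ 1)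
    {k : ℕ} (hk : l ≤ k) {v : Fin 2 → ℤ}
    (hv : ‖rowInv z v‖ ≤ b * ‖rowInv z ![1, 0]‖) :
    ‖rowInv z v‖ ^ k ≤ b ^ (l - 4) * l ^ 4 * ‖rowInv z ![1, 0]‖ ^ k * ‖rowInv z v‖ ^ 4 := by
  have hl := h.lt
  have hm := h.one_le
  obtain ⟨i, rfl⟩ : ∃ i, k = i + 4 := ⟨k - 4, by omega⟩
  set ρ := ‖rowInv z ![1, 0]‖
  have h1 : 1 ≤ (l * ρ) ^ 4 := one_le_pow₀ h.one_le_mul_norm_leading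
  calc ‖rowInv z v‖ ^ (i + 4) = ‖rowInv z v‖ ^ i * ‖rowInv z v‖ ^ 4 := pow_add _ _ _
    _ ≤ (b * ρ) ^ i * ‖rowInv z v‖ ^ 4 := by gcongr
    _ = b ^ i * ρ ^ i * 1 * ‖rowInv z v‖ ^ 4 := by rw [mul_pow, mul_one]
    _ ≤ b ^ (l - 4) * ρ ^ i * (l * ρ) ^ 4 * ‖rowInv z v‖ ^ 4 := by
      gcongr ?_ * ρ ^ i * ?_ * _
      exact pow_le_pow_of_le_one hb0 hb1 (by omega)
    _ = _ := by ring

end IsSamplePoint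

/-- The four rows giving the leading terms `z ^ (-k)` and `(z - 1) ^ (-k)`. -/
def nearRows : Finset (Fin 2 → ℤ) := {![1, 0], ![-1, 0], ![1, -1], ![-1, 1]}

lemma nearRows_subset : (nearRows : Set (Fin 2 → ℤ)) ⊆ lowerRows := by
  intro v hv
  simp only [nearRows, Finset.coe_insert, Finset.coe_singleton, Set.mem_insert_iff,
    Set.mem_singleton_iff] at hv
  rcases hv with rfl | rfl | rfl | rfl <;>
    refine ⟨Int.isCoprime_iff_gcd_eq_one.2 ?_, ?_⟩ <;> simp

namespace IsSamplePoint

variable {z : ℍ} {l m : ℕ} {T δ : ℝ}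

lemma sum_nearRows (h : IsSamplePoint z l m T δ) {k : ℕ} (hk : Even k) :
    ∑ v ∈ nearRows, rowInv z v ^ k = 4 * ((rowInv z ![1, 0] ^ k).re : ℂ) := by
  have h1 : rowInv z ![-1, 0] = -rowInv z ![1, 0] := by
    simp [rowInv, ← inv_neg]
  have hc : (starRingEnd ℂ) (z : ℂ) = 1 - z := by
    apply Complex.ext
    · simp only [Complex.conj_re, Complex.sub_re, Complex.one_re, coe_re, h.re_eq]
      norm_num
    · simp
  have h2 : rowInv z ![1, -1] = -(starRingEnd ℂ) (rowInv z ![1, 0]) := by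
    simp [rowInv, ← inv_neg, hc, sub_eq_add_neg]
  have h3 : rowInv z ![-1, 1] = (starRingEnd ℂ) (rowInv z ![1, 0]) := by
    simp [rowInv, hc, sub_eq_add_neg, add_comm]
  have e : ∑ v ∈ nearRows, rowInv z v ^ k = rowInv z ![1, 0] ^ k + (rowInv z ![-1, 0] ^ k
      + (rowInv z ![1, -1] ^ k + rowInv z ![-1, 1] ^ k)) := by
    rw [nearRows, Finset.sum_insert, Finset.sum_insert, Finset.sum_insert, Finset.sum_singleton] <;>
      decide
  rw [e, h1, h2, h3, hk.neg_pow, hk.neg_pow, ← map_pow]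
  have := Complex.add_conj (rowInv z ![1, 0] ^ k)
  push_cast at this
  linear_combination 2 * this

lemma bad_of_notMem_nearRows (h : IsSamplePoint z l m T δ) (hT : 1 / 4 ≤ T) {x : ℝ} (hx : 2 ≤ x)
    {v : Fin 2 → ℤ} (hv : v ∈ lowerRows) (hvn : v ∉ nearRows) :
    ‖rowInv z v‖ ≤ Real.exp (-(1 / (6 * x ^ 2))) * ‖rowInv z ![1, 0]‖ := by
  refine norm_rowInv_le_of_bad h.T_pos h.T_sq_lt.le h.re_eq h.im_eq hv hx ?_
  by_cases hv1 : v 0 = 1 ∨ v 0 = -1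
  · right
    have hn : 3 ≤ |v 0 * (v 0 + 2 * v 1)| := by
      have hv' : ∀ a b, v 0 = a → v 1 = b → v = ![a, b] := by
        rintro a b rfl rfl
        ext i
        fin_cases i <;> rfl
      by_contra hlt
      push Not at hlt
      obtain ⟨ha, hb⟩ := abs_lt.1 hlt
      simp only [nearRows, Finset.mem_insert, Finset.mem_singleton, not_or] at hvn
      obtain ⟨n1, n2, n3, n4⟩ := hvn
      rcases hv1 with h0 | h0 <;> rw [h0] at ha hb
      · rcases (by omega : v 1 = 0 ∨ v 1 = -1) with h1 | h1
        · exact n1 (hv' _ _ h0 h1)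
        · exact n3 (hv' _ _ h0 h1)
      · rcases (by omega : v 1 = 0 ∨ v 1 = 1) with h1 | h1
        · exact n2 (hv' _ _ h0 h1)
        · exact n4 (hv' _ _ h0 h1)
    refine ⟨hn, ?_⟩
    have hn' : (3 : ℝ) ≤ |((v 0 * (v 0 + 2 * v 1) : ℤ) : ℝ)| := by exact_mod_cast hn
    rw [abs_mul, abs_of_pos h.T_pos]
    calc 1 / x ≤ 1 / 2 := one_div_le_one_div_of_le (by norm_num) hx
      _ ≤ 3 * (1 / 4) := by norm_num
      _ ≤ _ := by gcongr
  · exact Or.inl hv1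

/-- Away from the cusp only the four leading rows matter. -/
lemma norm_E_sub_leading_le (h : IsSamplePoint z l m T δ) (hT : 1 / 4 ≤ T) {x K : ℝ} (hx : 2 ≤ x)
    (hK : ∑' v : Fin 2 → ℤ, ‖rowInv z v‖ ^ 4 ≤ K)
    (hxK : Real.exp (-(1 / (6 * x ^ 2))) ^ (l - 4) * (l ^ 4 * K) ≤ 1 / 100)
    {k : ℕ} (hk : 3 ≤ k) (hk2 : Even k) (hlk : l ≤ k) :
    ‖ModularForm.E hk z - 1 - 2 * ((rowInv z ![1, 0] ^ k).re : ℂ)‖ ≤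
      ‖rowInv z ![1, 0]‖ ^ k / 200 := by
  have hs := summable_rowInv_pow z hk
  have hset : lowerRows = (nearRows : Set (Fin 2 → ℤ)) ∪ (lowerRows \ nearRows) :=
    (Set.union_sdiff_cancel nearRows_subset).symm
  have hsplit : ∑' v : lowerRows, rowInv z v ^ k = 4 * ((rowInv z ![1, 0] ^ k).re : ℂ)
      + ∑' v : (lowerRows \ nearRows : Set (Fin 2 → ℤ)), rowInv z v ^ k := by
    conv_lhs => rw [hset]
    rw [Summable.tsum_union_disjoint (f := fun v ↦ rowInv z v ^ k) Set.disjoint_sdiff_right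
      (hs.subtype _) (hs.subtype _),
      Finset.tsum_subtype' nearRows (fun v ↦ rowInv z v ^ k), h.sum_nearRows hk2]
  have e : ModularForm.E hk z - 1 - 2 * ((rowInv z ![1, 0] ^ k).re : ℂ)
      = (1 / 2) * ∑' v : (lowerRows \ nearRows : Set (Fin 2 → ℤ)), rowInv z v ^ k := by
    rw [E_eq_one_add hk hk2, hsplit]
    ring
  set b := Real.exp (-(1 / (6 * x ^ 2))) with hb
  have hb1 : b ≤ 1 := Real.exp_le_one_iff.2 (by simp only [Left.neg_nonpos_iff]; positivity)
  set ρ := ‖rowInv z ![1, 0]‖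
  have hρ := h.norm_leading_pos
  have h4 := summable_norm_rowInv_pow z (k := 4) (by norm_num)
  have hbound : ‖∑' v : (lowerRows \ nearRows : Set (Fin 2 → ℤ)), rowInv z v ^ k‖
      ≤ b ^ (l - 4) * l ^ 4 * ρ ^ k * K := by
    refine (tsum_of_norm_bounded (((h4.subtype _).mul_left
      (b ^ (l - 4) * l ^ 4 * ρ ^ k)).hasSum) fun v ↦ ?_).trans ?_
    · rw [norm_pow]
      exact h.norm_rowInv_pow_le_of_bad (Real.exp_pos _).le hb1 hlk
        (h.bad_of_notMem_nearRows hT hx v.2.1 v.2.2)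
    · rw [tsum_mul_left]
      gcongr
      exact (Summable.tsum_subtype_le (fun v ↦ ‖rowInv z v‖ ^ 4) _
            (fun v ↦ by positivity) h4).trans hK
  rw [e, norm_mul]
  have : ρ ^ k * (b ^ (l - 4) * (l ^ 4 * K)) ≤ ρ ^ k * (1 / 100) := by gcongr
  norm_num
  linarith

lemma sign_mul_leading_pow (h : IsSamplePoint z l m T δ) :
    (-1 : ℂ) ^ (l / 2 + m) * rowInv z ![1, 0] ^ l = (‖rowInv z ![1, 0]‖ ^ l : ℝ) :=
  sign_mul_rowInv_pow_of_near h.even h.T_pos h.mul_eq h.arctan_eq h.re_eq h.im_eq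
    (v := ![1, 0]) (by simp) (by simp)

lemma sign_mul_delta_pos_of_ge (h : IsSamplePoint z l m T δ) (hT : 1 / 4 ≤ T) {x K : ℝ}
    (hx : 2 ≤ x) (hK : ∑' v : Fin 2 → ℤ, ‖rowInv z v‖ ^ 4 ≤ K)
    (hxK : Real.exp (-(1 / (6 * x ^ 2))) ^ (l - 4) * (l ^ 4 * K) ≤ 1 / 100)
    {k : ℕ} (hk : 3 ≤ k) (hl : 3 ≤ l) (hk2 : Even k) (hlk : l ≤ k) :
    0 < ((-1 : ℂ) ^ (l / 2 + m) * eisensteinDelta hk hl z).re := by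
  set ε : ℂ := (-1 : ℂ) ^ (l / 2 + m) with hε
  have hε2 : ε * ε = 1 := by rw [hε, ← mul_pow]; simp
  have hεn : ‖ε‖ = 1 := by simp [hε]
  have b1 := h.norm_E_sub_leading_le hT hx hK hxK hl h.even le_rfl
  have b2 := h.norm_E_sub_leading_le hT hx hK hxK hk hk2 hlk
  have b3 := h.norm_E_sub_leading_le hT hx hK hxK (k := k + l)
    (hk.trans (Nat.le_add_right k l)) (hk2.add h.even) (by omega)
  have hlead := h.sign_mul_leading_pow
  obtain ⟨a, rfl⟩ := Nat.exists_eq_add_of_le hlk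
  have ha : Even a := (Nat.even_add.1 hk2).1 h.even
  have hc := h.neg_half_le_re_leading_pow ha
  have hq := h.norm_leading_pow_le_quarter
  have hρ1 := h.norm_leading_le_one
  have hρ0 := h.norm_leading_pos
  rw [← hε] at hlead
  set ζ := rowInv z ![1, 0]
  set P : ℝ := ‖ζ‖ ^ l with hP
  have hP0 : 0 < P := by positivity
  obtain ⟨s, hs⟩ : ∃ s : ℝ, ε = s ∧ (s = 1 ∨ s = -1) := by
    rcases neg_one_pow_eq_or ℂ (l / 2 + m) with h | h
    · exact ⟨1, by rw [hε, h]; simp, Or.inl rfl⟩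
    · exact ⟨-1, by rw [hε, h]; simp, Or.inr rfl⟩
  obtain ⟨hs, hs1⟩ := hs
  have hζl : ζ ^ l = ((s * P : ℝ) : ℂ) := by
    have : ζ ^ l = ε * (ε * ζ ^ l) := by rw [← mul_assoc, hε2, one_mul]
    rw [this, hlead, hs]
    push_cast
    rfl
  have hss : s * s = 1 := by rcases hs1 with h | h <;> rw [h] <;> norm_num
  set c : ℝ := (ζ ^ a).re with hcdef
  have hc1 : |c| ≤ 1 := (Complex.abs_re_le_norm _).trans (by
    rw [norm_pow]; exact pow_le_one₀ (norm_nonneg _) hρ1)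
  have r1 : (ζ ^ l).re = s * P := by rw [hζl, Complex.ofReal_re]
  have r2 : (ζ ^ (l + a)).re = s * P * c := by rw [pow_add, hζl, Complex.re_ofReal_mul]
  have r3 : (ζ ^ (l + a + l)).re = P * P * c := by
    rw [pow_add, pow_add, hζl, show ((s * P : ℝ) : ℂ) * ζ ^ a * ((s * P : ℝ) : ℂ)
      = ((s * s * (P * P) : ℝ) : ℂ) * ζ ^ a by push_cast; ring, Complex.re_ofReal_mul, hss, one_mul]
  rw [r1] at b1
  rw [r2] at b2
  rw [r3] at b3
  have q2 : ‖ζ‖ ^ (l + a) ≤ P := pow_le_pow_of_le_one (norm_nonneg _) hρ1 (by omega)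
  have q3 : ‖ζ‖ ^ (l + a + l) ≤ P := pow_le_pow_of_le_one (norm_nonneg _) hρ1 (by omega)
  rw [eisensteinDelta]
  set e1 := ModularForm.E hl z - 1 - 2 * ((s * P : ℝ) : ℂ) with he1
  set e2 := ModularForm.E hk z - 1 - 2 * ((s * P * c : ℝ) : ℂ) with he2
  set e3 := ModularForm.E (hk.trans (Nat.le_add_right (l + a) l)) z - 1
    - 2 * ((P * P * c : ℝ) : ℂ) with he3
  have n1 : ‖e1‖ ≤ P / 200 := b1
  have n2 : ‖e2‖ ≤ P / 200 := by linarith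
  have n3 : ‖e3‖ ≤ P / 200 := by linarith
  set R : ℂ := e2 + e1 + 2 * ((s * P * c : ℝ) : ℂ) * e1 + 2 * ((s * P : ℝ) : ℂ) * e2
    + e2 * e1 - e3 with hR
  have hmain : ε * (ModularForm.E hk z * ModularForm.E hl z
      - ModularForm.E (hk.trans (Nat.le_add_right (l + a) l)) z)
      = ((2 * P * (1 + c * (1 + s * P)) : ℝ) : ℂ) + ε * R := by
    have hssc : (s : ℂ) * s = 1 := by exact_mod_cast hss
    have x1 : ModularForm.E hl z = e1 + 1 + 2 * ((s * P : ℝ) : ℂ) := by rw [he1]; ring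
    have x2 : ModularForm.E hk z = e2 + 1 + 2 * ((s * P * c : ℝ) : ℂ) := by rw [he2]; ring
    have x3 : ModularForm.E (hk.trans (Nat.le_add_right (l + a) l)) z
      = e3 + 1 + 2 * ((P * P * c : ℝ) : ℂ) := by rw [he3]; ring
    rw [x1, x2, x3, hR, hs]
    push_cast
    linear_combination (2 * P * c + 2 * P + 4 * s * P ^ 2 * c : ℂ) * hssc
  have hRn : ‖R‖ ≤ P / 25 := by
    have hsP : |s * P| ≤ 1 := by
      rw [abs_mul, abs_of_pos hP0]
      rcases hs1 with h | h <;> rw [h] <;> norm_num <;> linarith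
    have hsPc : |s * P * c| ≤ 1 := by
      rw [abs_mul]
      exact mul_le_one₀ hsP (abs_nonneg _) hc1
    have t1 : ‖2 * ((s * P * c : ℝ) : ℂ) * e1‖ ≤ 2 * 1 * (P / 200) := by
      rw [norm_mul, norm_mul, Complex.norm_real, Complex.norm_ofNat, Real.norm_eq_abs]
      gcongr
    have t2 : ‖2 * ((s * P : ℝ) : ℂ) * e2‖ ≤ 2 * 1 * (P / 200) := by
      rw [norm_mul, norm_mul, Complex.norm_real, Complex.norm_ofNat, Real.norm_eq_abs]
      gcongr
    have t3 : ‖e2 * e1‖ ≤ P / 200 * 1 := by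
      rw [norm_mul]
      gcongr
      linarith
    have u1 := norm_sub_le (e2 + e1 + 2 * ((s * P * c : ℝ) : ℂ) * e1
      + 2 * ((s * P : ℝ) : ℂ) * e2 + e2 * e1) e3
    have u2 := norm_add_le (e2 + e1 + 2 * ((s * P * c : ℝ) : ℂ) * e1
      + 2 * ((s * P : ℝ) : ℂ) * e2) (e2 * e1)
    have u3 := norm_add_le (e2 + e1 + 2 * ((s * P * c : ℝ) : ℂ) * e1) (2 * ((s * P : ℝ) : ℂ) * e2)
    have u4 := norm_add_le (e2 + e1) (2 * ((s * P * c : ℝ) : ℂ) * e1)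
    have u5 := norm_add_le e2 e1
    rw [hR]
    linarith
  have hre : -(P / 25) ≤ (ε * R).re := by
    have := (abs_le.1 (Complex.abs_re_le_norm (ε * R))).1
    rw [norm_mul, hεn, one_mul] at this
    linarith
  have hsP' : 3 / 4 ≤ 1 + s * P ∧ 1 + s * P ≤ 5 / 4 := by
    rcases hs1 with h | h <;> rw [h] <;> constructor <;> linarith
  have hF : 3 / 8 ≤ 1 + c * (1 + s * P) := by nlinarith
  rw [hmain, Complex.add_re, Complex.ofReal_re]
  nlinarith

/-- Near the cusp many rows contribute, but all relevant ones with the same sign. -/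
lemma half_tsum_sub_le_sign_mul_re (h : IsSamplePoint z l m T δ) {x K : ℝ}
    (hx : 2 ≤ x) (hxl : x ^ 3 = l) (hK : ∑' v : Fin 2 → ℤ, ‖rowInv z v‖ ^ 4 ≤ K)
    (hxK : Real.exp (-(1 / (6 * x ^ 2))) ^ (l - 4) * (l ^ 4 * K) ≤ 1 / 100) (hl : 3 ≤ l) :
    1 / 2 * ∑' v : lowerRows, ‖rowInv z v‖ ^ l - 3 / 200 * ‖rowInv z ![1, 0]‖ ^ l ≤
      ((-1 : ℂ) ^ (l / 2 + m) * ∑' v : lowerRows, rowInv z v ^ l).re := by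
  set b := Real.exp (-(1 / (6 * x ^ 2))) with hb
  have hb1 : b ≤ 1 := Real.exp_le_one_iff.2 (by simp only [Left.neg_nonpos_iff]; positivity)
  have hb0 : 0 ≤ b := (Real.exp_pos _).le
  set ρ := ‖rowInv z ![1, 0]‖ with hρdef
  have hρ := h.norm_leading_pos
  have h4 := summable_norm_rowInv_pow z (k := 4) (by norm_num)
  have hsl := summable_norm_rowInv_pow z hl
  have hs := summable_rowInv_pow z hl
  set ε : ℂ := (-1 : ℂ) ^ (l / 2 + m) with hε
  have hεn : ‖ε‖ = 1 := by simp [hε]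
  set C := b ^ (l - 4) * l ^ 4 * ρ ^ l with hC
  have hC0 : 0 ≤ C := by positivity
  have hpt : ∀ v : lowerRows, 1 / 2 * ‖rowInv z v‖ ^ l - 3 / 2 * C * ‖rowInv z v‖ ^ 4
      ≤ (ε * rowInv z v ^ l).re := by
    intro v
    have habs : -‖rowInv z v‖ ^ l ≤ (ε * rowInv z v ^ l).re := by
      have := (abs_le.1 (Complex.abs_re_le_norm (ε * rowInv z v ^ l))).1
      rwa [norm_mul, hεn, one_mul, norm_pow] at this
    have hCv : 0 ≤ C * ‖rowInv z v‖ ^ 4 := by positivity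
    by_cases hbad : ‖rowInv z v‖ ≤ b * ρ
    · have := h.norm_rowInv_pow_le_of_bad hb0 hb1 le_rfl hbad
      rw [← hρdef, ← hC] at this
      linarith
    · have hgood : 1 / 2 * ‖rowInv z v‖ ^ l ≤ (ε * rowInv z v ^ l).re := by
        have hnb := fun hh ↦ hbad (norm_rowInv_le_of_bad h.T_pos h.T_sq_lt.le h.re_eq h.im_eq
          v.2 hx hh)
        obtain ⟨hv1, hv2⟩ := not_or.1 hnb
        rw [not_not] at hv1
        by_cases h3 : 3 ≤ |v.1 0 * (v.1 0 + 2 * v.1 1)|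
        · refine half_norm_le_sign_mul_re_of_good h.even h.T_pos h.mul_eq h.arctan_eq h.re_eq
            h.im_eq hv1 (by linarith) hxl ?_
          by_contra hlt
          exact hv2 ⟨h3, (not_le.1 hlt).le⟩
        · have hn : v.1 0 * (v.1 0 + 2 * v.1 1) = 1 ∨ v.1 0 * (v.1 0 + 2 * v.1 1) = -1 := by
            obtain ⟨ha, hb⟩ := abs_lt.1 (not_le.1 h3)
            rcases hv1 with h0 | h0 <;> rw [h0] at ha hb ⊢ <;> omega
          rw [hε, sign_mul_rowInv_pow_of_near h.even h.T_pos h.mul_eq h.arctan_eq h.re_eq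
            h.im_eq hv1 hn, Complex.ofReal_re]
          have : 0 ≤ ‖rowInv z v‖ ^ l := by positivity
          linarith
      linarith
  have hsR : Summable fun v : lowerRows ↦ ε * rowInv z v ^ l := (hs.subtype lowerRows).mul_left ε
  have h4R : Summable fun v : lowerRows ↦ 3 / 2 * C * ‖rowInv z v‖ ^ 4 :=
    (h4.subtype lowerRows).mul_left _
  have hslR : Summable fun v : lowerRows ↦ 1 / 2 * ‖rowInv z v‖ ^ l :=
    (hsl.subtype lowerRows).mul_left _
  have hsum := (hslR.sub h4R).tsum_le_tsum hpt (Complex.reCLM.summable hsR)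
  rw [hslR.tsum_sub h4R, tsum_mul_left, tsum_mul_left, ← Complex.re_tsum hsR,
    tsum_mul_left] at hsum
  have hK' : ∑' v : lowerRows, ‖rowInv z v‖ ^ 4 ≤ K :=
    (Summable.tsum_subtype_le (fun v ↦ ‖rowInv z v‖ ^ 4) _ (fun v ↦ by positivity) h4).trans hK
  have : C * ∑' v : lowerRows, ‖rowInv z v‖ ^ 4 ≤ 1 / 100 * ρ ^ l := by
    calc _ ≤ C * K := by gcongr
      _ = b ^ (l - 4) * (l ^ 4 * K) * ρ ^ l := by rw [hC]; ring
      _ ≤ _ := by gcongr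
  linarith

lemma norm_E_sub_one_le (h : IsSamplePoint z l m T δ) {k : ℕ} (hk : 3 ≤ k) (hl : 3 ≤ l)
    (hk2 : Even k) (hlk : l ≤ k) :
    ‖ModularForm.E hk z - 1‖ ≤
      1 / 2 * (‖rowInv z ![1, 0]‖ ^ (k - l) * ∑' v : lowerRows, ‖rowInv z v‖ ^ l) := by
  have hsl := summable_norm_rowInv_pow z hl
  rw [E_eq_one_add hk hk2, add_sub_cancel_left, norm_mul]
  norm_num
  rw [← tsum_mul_left]
  refine tsum_of_norm_bounded ((hsl.subtype lowerRows).mul_left _).hasSum fun v ↦ ?_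
  rw [norm_pow]
  calc ‖rowInv z v‖ ^ k = ‖rowInv z v‖ ^ (k - l) * ‖rowInv z v‖ ^ l := by
        rw [← pow_add, Nat.sub_add_cancel hlk]
    _ ≤ _ := by
      simp only [Function.comp_apply]
      gcongr
      exact h.norm_rowInv_le v.2

lemma sign_mul_delta_pos_of_le (h : IsSamplePoint z l m T δ) (hT : T ≤ 1 / 4) {x K : ℝ}
    (hx : 2 ≤ x) (hxl : x ^ 3 = l) (hK : ∑' v : Fin 2 → ℤ, ‖rowInv z v‖ ^ 4 ≤ K)
    (hxK : Real.exp (-(1 / (6 * x ^ 2))) ^ (l - 4) * (l ^ 4 * K) ≤ 1 / 100)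
    {k : ℕ} (hk : 3 ≤ k) (hl : 3 ≤ l) (hk2 : Even k) (hlk : l ≤ k) :
    0 < ((-1 : ℂ) ^ (l / 2 + m) * eisensteinDelta hk hl z).re := by
  have a1 := h.half_tsum_sub_le_sign_mul_re hx hxl hK hxK hl
  have a2 := h.norm_E_sub_one_le hl hl h.even le_rfl
  have a3 := h.norm_E_sub_one_le hk hl hk2 hlk
  have a4 := h.norm_E_sub_one_le (k := k + l) (hk.trans (Nat.le_add_right k l)) hl
    (hk2.add h.even) (by omega)
  have hl8 : 8 ≤ l := by have := h.lt; have := h.one_le; omega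
  have hρ0 := h.norm_leading_pos
  have hρsq : ‖rowInv z ![1, 0]‖ ^ 2 ≤ 1 / 4 := by
    have hT0 := h.T_pos
    rw [h.norm_leading_sq, div_le_iff₀ (by positivity)]
    nlinarith
  have h4 := summable_norm_rowInv_pow z (k := 4) (by norm_num)
  have hsl := summable_norm_rowInv_pow z hl
  have h4R : Summable fun v : lowerRows ↦ ‖rowInv z v‖ ^ 4 := h4.subtype lowerRows
  have hslR : Summable fun v : lowerRows ↦ ‖rowInv z v‖ ^ l := hsl.subtype lowerRows
  have hSlow : ‖rowInv z ![1, 0]‖ ^ l ≤ ∑' v : lowerRows, ‖rowInv z v‖ ^ l :=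
    hslR.le_tsum ⟨![1, 0], nearRows_subset (by simp [nearRows])⟩ (fun v _ ↦ by positivity)
  -- here `ρ ≤ 1/2 ≤ b`, so each term is at most `b ^ (l - 4)` times its counterpart of weight `4`
  have hSup : ∑' v : lowerRows, ‖rowInv z v‖ ^ l ≤ 1 / 100 := by
    set b := Real.exp (-(1 / (6 * x ^ 2))) with hb
    have hbρ : ‖rowInv z ![1, 0]‖ ≤ b := by
      have h1 : ‖rowInv z ![1, 0]‖ ≤ 1 / 2 := by
        rw [← pow_le_pow_iff_left₀ (norm_nonneg _) (by norm_num) two_ne_zero]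
        linarith
      have h2 := Real.add_one_le_exp (-(1 / (6 * x ^ 2)))
      have h3 : 1 / (6 * x ^ 2) ≤ 1 / 2 :=
        one_div_le_one_div_of_le (by norm_num) (by nlinarith)
      linarith
    have hK0 : 0 ≤ K := (tsum_nonneg fun v ↦ by positivity).trans hK
    calc ∑' v : lowerRows, ‖rowInv z v‖ ^ l
        ≤ ∑' v : lowerRows, b ^ (l - 4) * ‖rowInv z v‖ ^ 4 := by
          refine hslR.tsum_le_tsum (fun v ↦ ?_) (h4R.mul_left _)
          rw [show ‖rowInv z v‖ ^ l = ‖rowInv z v‖ ^ (l - 4) * ‖rowInv z v‖ ^ 4 by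
            rw [← pow_add, Nat.sub_add_cancel (by omega)]]
          gcongr
          exact (h.norm_rowInv_le v.2).trans hbρ
      _ = b ^ (l - 4) * ∑' v : lowerRows, ‖rowInv z v‖ ^ 4 := tsum_mul_left
      _ ≤ b ^ (l - 4) * (1 * K) := by
          rw [one_mul]
          gcongr
          exact (Summable.tsum_subtype_le (fun v ↦ ‖rowInv z v‖ ^ 4) _
            (fun v ↦ by positivity) h4).trans hK
      _ ≤ b ^ (l - 4) * (l ^ 4 * K) := by
          gcongr
          exact one_le_pow₀ (by exact_mod_cast (by omega : 1 ≤ l))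
      _ ≤ 1 / 100 := hxK
  rw [show ∑' v : lowerRows, rowInv z v ^ l = 2 * (ModularForm.E hl z - 1) by
    rw [E_eq_one_add hl h.even]; ring] at a1
  set ε : ℂ := (-1 : ℂ) ^ (l / 2 + m) with hε
  have hεn : ‖ε‖ = 1 := by simp [hε]
  set S := ∑' v : lowerRows, ‖rowInv z v‖ ^ l
  set ρ := ‖rowInv z ![1, 0]‖ with hρ
  have hS0 : 0 < S := lt_of_lt_of_le (by positivity) hSlow
  rw [Nat.sub_self, pow_zero, one_mul] at a2
  rw [Nat.add_sub_cancel] at a4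
  have hρ1 : ρ ≤ 1 := h.norm_leading_le_one
  have a3' : ‖ModularForm.E hk z - 1‖ ≤ 1 / 200 := by
    have : ρ ^ (k - l) * S ≤ 1 * S := by gcongr; exact pow_le_one₀ hρ0.le hρ1
    linarith
  have a4' : ‖ModularForm.E (hk.trans (Nat.le_add_right k l)) z - 1‖ ≤ S / 200 := by
    have : ρ ^ k ≤ ρ ^ l := pow_le_pow_of_le_one hρ0.le hρ1 hlk
    have : ρ ^ k * S ≤ 1 / 100 * S := by gcongr; linarith
    linarith
  rw [eisensteinDelta]
  set A := ModularForm.E hl z - 1 with hA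
  set B := ModularForm.E (hk.trans (Nat.le_add_right k l)) z - 1 with hB
  set D := ModularForm.E hk z - 1 with hD
  have hmain : ε * (ModularForm.E hk z * ModularForm.E hl z
      - ModularForm.E (hk.trans (Nat.le_add_right k l)) z)
      = ε * A + ε * D + (ε * (D * A) - ε * B) := by
    rw [hA, hB, hD]; ring
  have hA1 : 47 / 200 * S ≤ (ε * A).re := by
    rw [show ε * (2 * A) = ((2 : ℝ) : ℂ) * (ε * A) by push_cast; ring,
      Complex.re_ofReal_mul] at a1
    linarith
  have hDA : -(1 / 400 * S) ≤ (ε * (D * A)).re := by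
    have := (abs_le.1 (Complex.abs_re_le_norm (ε * (D * A)))).1
    rw [norm_mul, hεn, one_mul, norm_mul] at this
    have : ‖D‖ * ‖A‖ ≤ 1 / 200 * (1 / 2 * S) := by gcongr
    linarith
  have hBr : (ε * B).re ≤ S / 200 := by
    have := (abs_le.1 (Complex.abs_re_le_norm (ε * B))).2
    rw [norm_mul, hεn, one_mul] at this
    linarith
  have hDr : -(1 / 8 * S) ≤ (ε * D).re := by
    rcases hlk.eq_or_lt with rfl | hlt
    · have : 0 < 47 / 200 * S := by positivity
      have e : D = A := rfl
      rw [e]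
      linarith
    · have hkl : 2 ≤ k - l := by
        obtain ⟨i, hi⟩ := hk2
        obtain ⟨j, hj⟩ := h.even
        omega
      have h1 : ρ ^ (k - l) ≤ ρ ^ 2 := pow_le_pow_of_le_one hρ0.le hρ1 hkl
      have h2 : ρ ^ (k - l) * S ≤ 1 / 4 * S := by gcongr; linarith
      have := (abs_le.1 (Complex.abs_re_le_norm (ε * D))).1
      rw [norm_mul, hεn, one_mul] at this
      linarith
  rw [hmain, Complex.add_re, Complex.add_re, Complex.sub_re]
  linarith

end IsSamplePoint

/-- The sign of `Δ` alternates along the sample points, uniformly in the weights. -/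
theorem exists_sign_mul_delta_pos : ∃ L : ℕ, 8 ≤ L ∧ ∀ (k l : ℕ) (hk : 3 ≤ k) (hl : 3 ≤ l), Even k →
    L ≤ l → l ≤ k → ∀ (z : ℍ) (m : ℕ) (T δ : ℝ), IsSamplePoint z l m T δ →
      0 < ((-1 : ℂ) ^ (l / 2 + m) * eisensteinDelta hk hl z).re := by
  obtain ⟨K, hK0, hK⟩ := exists_tsum_norm_rowInv_pow_four_le
  obtain ⟨L, hL8, hL⟩ := exists_forall_pow_mul_exp_le K hK0
  refine ⟨L, hL8, fun k l hk hl hk2 hLl hlk z m T δ h ↦ ?_⟩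
  obtain ⟨x, hx, hxl, hxK⟩ := hL l hLl
  have hKz := hK z h.re_eq h.sqrt_three_div_two_lt_im.le
  rcases le_total T (1 / 4) with hT | hT
  · exact h.sign_mul_delta_pos_of_le hT hx hxl hKz hxK hk hl hk2 hlk
  · exact h.sign_mul_delta_pos_of_ge hT hx hKz hxK hk hl hk2 hlk

/-! ### Zeros between consecutive sample points -/

lemma delta_im_eq_zero {k l : ℕ} (hk : 3 ≤ k) (hl : 3 ≤ l) (hk2 : Even k) (hl2 : Even l) {z : ℍ}
    (hre : z.re = 1 / 2) : (eisensteinDelta hk hl z).im = 0 := by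
  rw [← Complex.conj_eq_iff_im, eisensteinDelta, map_sub, map_mul, conj_E_eq hk hk2 hre,
    conj_E_eq hl hl2 hre, conj_E_eq _ (hk2.add hl2) hre]

lemma continuous_delta {k l : ℕ} (hk : 3 ≤ k) (hl : 3 ≤ l) : Continuous (eisensteinDelta hk hl) :=
  ((ModularFormClass.continuous (ModularForm.E hk)).mul
    (ModularFormClass.continuous (ModularForm.E hl))).sub
    (ModularFormClass.continuous (ModularForm.E _))

/-- The line `Re z = 1/2`, parametrised by the logarithm of the height. -/
noncomputable def sideLine (t : ℝ) : ℍ := ⟨⟨1 / 2, Real.exp t⟩, Real.exp_pos t⟩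

lemma continuous_sideLine : Continuous sideLine := by
  rw [UpperHalfPlane.isEmbedding_coe.continuous_iff]
  have : (UpperHalfPlane.coe ∘ sideLine) = fun t : ℝ ↦ (1 / 2 : ℂ) + (Real.exp t : ℂ) * Complex.I := by
    funext t
    apply Complex.ext <;> simp [sideLine, Complex.exp_ofReal_re]
  rw [this]
  fun_prop

/-- The logarithmic height of the `m`-th sample point. -/
noncomputable def sampleHeight (l m : ℕ) : ℝ := Real.log (1 / (2 * Real.tan (Real.pi * m / l)))

lemma pi_mul_div_mem {l m : ℕ} (h1 : 1 ≤ m) (h2 : 6 * m + 2 ≤ l) :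
    0 < Real.pi * m / l ∧ Real.pi * m / l < Real.pi / 2 := by
  have hm : (1 : ℝ) ≤ m := by exact_mod_cast h1
  have hl : (6 * m + 2 : ℝ) ≤ l := by exact_mod_cast h2
  constructor
  · have : (0 : ℝ) < l := by linarith
    positivity
  · rw [div_lt_div_iff₀ (by linarith) (by norm_num)]
    nlinarith [Real.pi_pos]

lemma isSamplePoint_sideLine {l m : ℕ} (hl : Even l) (h1 : 1 ≤ m) (h2 : 6 * m + 2 ≤ l) :
    IsSamplePoint (sideLine (sampleHeight l m)) l m (Real.tan (Real.pi * m / l))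
      (Real.pi * m / l) where
  even := hl
  one_le := h1
  lt := h2
  mul_eq := by
    have : (l : ℝ) ≠ 0 := by exact_mod_cast (by omega : l ≠ 0)
    field_simp
  tan_eq := rfl
  re_eq := rfl
  im_eq := by
    obtain ⟨ha, hb⟩ := pi_mul_div_mem h1 h2
    have := Real.tan_pos_of_pos_of_lt_pi_div_two ha hb
    exact Real.exp_log (by positivity)

lemma sampleHeight_lt {l m n : ℕ} (h1 : 1 ≤ m) (hmn : m < n) (h2 : 6 * n + 2 ≤ l) :
    sampleHeight l n < sampleHeight l m := by
  obtain ⟨ha, hb⟩ := pi_mul_div_mem (l := l) h1 (by omega)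
  obtain ⟨hc, hd⟩ := pi_mul_div_mem (l := l) (by omega : 1 ≤ n) h2
  have hl : (0 : ℝ) < l := by exact_mod_cast (by omega : 0 < l)
  have hmn' : (m : ℝ) < n := by exact_mod_cast hmn
  have t1 := Real.tan_pos_of_pos_of_lt_pi_div_two ha hb
  have t2 := Real.tan_pos_of_pos_of_lt_pi_div_two hc hd
  have t3 : Real.tan (Real.pi * m / l) < Real.tan (Real.pi * n / l) :=
    Real.tan_lt_tan_of_lt_of_lt_pi_div_two (by linarith) hd (by gcongr)
  exact Real.log_lt_log (by positivity) (one_div_lt_one_div_of_lt (by positivity) (by linarith))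

lemma exists_mem_sideZeros_between {k l : ℕ} (hk : 3 ≤ k) (hl : 3 ≤ l) (hk2 : Even k)
    (hl2 : Even l) {m : ℕ} (hm : 1 ≤ m) (hml : 6 * (m + 1) + 2 ≤ l)
    (hsign : ∀ (z : ℍ) (m : ℕ) (T δ : ℝ), IsSamplePoint z l m T δ →
      0 < ((-1 : ℂ) ^ (l / 2 + m) * eisensteinDelta hk hl z).re) :
    ∃ t ∈ Set.Ioo (sampleHeight l (m + 1)) (sampleHeight l m), sideLine t ∈ sideZeros hk hl := by
  have s1 := isSamplePoint_sideLine hl2 hm (by omega : 6 * m + 2 ≤ l)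
  have s2 := isSamplePoint_sideLine hl2 (by omega : 1 ≤ m + 1) hml
  have p1 := hsign _ _ _ _ s1
  have p2 := hsign _ _ _ _ s2
  have hlt := sampleHeight_lt hm (Nat.lt_succ_self m) hml
  set f : ℝ → ℝ := fun t ↦ (eisensteinDelta hk hl (sideLine t)).re with hf
  have hcont : Continuous f :=
    Complex.continuous_re.comp ((continuous_delta hk hl).comp continuous_sideLine)
  have hre : ∀ (i : ℕ) (w : ℂ), ((-1 : ℂ) ^ i * w).re = (-1) ^ i * w.re := fun i w ↦ by
    rw [← Complex.re_ofReal_mul]; push_cast; rfl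
  rw [hre] at p1 p2
  rw [← add_assoc, pow_succ] at p2
  have hzero : ∃ t ∈ Set.Ioo (sampleHeight l (m + 1)) (sampleHeight l m), f t = 0 := by
    rcases neg_one_pow_eq_or ℝ (l / 2 + m) with h | h
    · rw [h] at p1 p2
      exact intermediate_value_Ioo hlt.le hcont.continuousOn
        ⟨by simp only [hf]; linarith, by simp only [hf]; linarith⟩
    · rw [h] at p1 p2
      exact intermediate_value_Ioo' hlt.le hcont.continuousOn
        ⟨by simp only [hf]; linarith, by simp only [hf]; linarith⟩
  obtain ⟨t, ht, hft⟩ := hzero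
  refine ⟨t, ht, rfl, ?_, ?_⟩
  · exact s2.sqrt_three_div_two_lt_im.trans (Real.exp_lt_exp.2 ht.1)
  · exact Complex.ext hft (delta_im_eq_zero hk hl hk2 hl2 rfl)

/-! ### Finiteness of the zero set -/

/-- In the coordinate `q = exp (2 π i z)` the function `Δ` extends holomorphically to the unit disc,
and the side `x = 1/2`, `y > √3/2` becomes a bounded segment well inside it. -/
lemma finite_sideZeros {k l : ℕ} (hk : 3 ≤ k) (hl : 3 ≤ l) {z₀ : ℍ}
    (h0 : eisensteinDelta hk hl z₀ ≠ 0) : (sideZeros hk hl).Finite := by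
  set F : ℂ → ℂ := fun q ↦ cuspFunction 1 (ModularForm.E hk) q * cuspFunction 1 (ModularForm.E hl) q
    - cuspFunction 1 (ModularForm.E (k := k + l) (hk.trans (Nat.le_add_right k l))) q with hF
  have hFq : ∀ z : ℍ, F (Function.Periodic.qParam 1 z) = eisensteinDelta hk hl z := fun z ↦ by
    simp only [hF, eisensteinDelta]
    rw [SlashInvariantFormClass.eq_cuspFunction _ z one_mem_strictPeriods_SL one_ne_zero,
      SlashInvariantFormClass.eq_cuspFunction _ z one_mem_strictPeriods_SL one_ne_zero,
      SlashInvariantFormClass.eq_cuspFunction _ z one_mem_strictPeriods_SL one_ne_zero]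
  have hnorm : ∀ z : ℍ, ‖Function.Periodic.qParam 1 z‖ = Real.exp (-2 * Real.pi * z.im) :=
    fun z ↦ by rw [Function.Periodic.norm_qParam, div_one]; rfl
  have hdiff : DifferentiableOn ℂ F (Metric.ball 0 1) := by
    intro q hq
    have hq1 : ‖q‖ < 1 := by simpa using hq
    have d := fun {k : ℕ} (hk : 3 ≤ k) ↦ ModularFormClass.differentiableAt_cuspFunction
      (ModularForm.E hk) one_pos one_mem_strictPeriods_SL hq1
    exact (((d hk).mul (d hl)).sub (d _)).differentiableWithinAt
  have han : AnalyticOnNhd ℂ F (Metric.ball 0 1) := hdiff.analyticOnNhd Metric.isOpen_ball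
  by_contra hinf
  have hinj : Set.InjOn (fun z : ℍ ↦ Function.Periodic.qParam 1 z) (sideZeros hk hl) := by
    intro z hz w hw hzw
    have h1 := congrArg norm hzw
    simp only [hnorm, Real.exp_eq_exp] at h1
    have him : z.im = w.im := mul_left_cancel₀ (by simp [Real.pi_ne_zero]) h1
    exact UpperHalfPlane.ext (Complex.ext (hz.1.trans hw.1.symm) him)
  have hinf2 := Set.Infinite.image hinj hinf
  have hr : Real.exp (-2 * Real.pi * (√3 / 2)) < 1 := by
    rw [Real.exp_lt_one_iff]
    have : 0 < Real.pi * √3 := by positivity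
    linarith
  have hsub : (fun z : ℍ ↦ Function.Periodic.qParam 1 z) '' sideZeros hk hl ⊆
      Metric.closedBall 0 (Real.exp (-2 * Real.pi * (√3 / 2))) := by
    rintro _ ⟨z, hz, rfl⟩
    simp only [mem_closedBall_zero_iff, hnorm, Real.exp_le_exp]
    nlinarith [Real.pi_pos, hz.2.1]
  obtain ⟨q, hq, hacc⟩ := hinf2.exists_accPt_of_subset_isCompact (isCompact_closedBall _ _) hsub
  have hq1 : q ∈ Metric.ball (0 : ℂ) 1 := Metric.closedBall_subset_ball hr hq
  have hfreq : ∃ᶠ w in nhdsWithin q {q}ᶜ, F w = 0 := by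
    rw [accPt_iff_frequently_nhdsNE] at hacc
    refine hacc.mono ?_
    rintro _ ⟨z, hz, rfl⟩
    exact (hFq z).trans hz.2.2
  have hzero := han.eqOn_zero_of_preconnected_of_frequently_eq_zero
    (convex_ball 0 1).isPreconnected hq1 hfreq
  apply h0
  rw [← hFq]
  refine hzero ?_
  rw [mem_ball_zero_iff, hnorm, Real.exp_lt_one_iff]
  nlinarith [mul_pos Real.pi_pos z₀.im_pos]

/-- Between the `(l - 2) / 6` sample points there are at least `(l - 2) / 6 - 1` zeros. -/
lemma le_ncard_sideZeros {k l : ℕ} (hk : 3 ≤ k) (hl : 3 ≤ l) (hk2 : Even k) (hl2 : Even l)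
    (hfin : (sideZeros hk hl).Finite)
    (hsign : ∀ (z : ℍ) (m : ℕ) (T δ : ℝ), IsSamplePoint z l m T δ →
      0 < ((-1 : ℂ) ^ (l / 2 + m) * eisensteinDelta hk hl z).re) :
    (l - 2) / 6 - 1 ≤ (sideZeros hk hl).ncard := by
  set M := (l - 2) / 6 with hM
  have hex : ∀ m : Fin (M - 1), ∃ t ∈ Set.Ioo (sampleHeight l (m + 1 + 1)) (sampleHeight l (m + 1)),
      sideLine t ∈ sideZeros hk hl := fun m ↦
    exists_mem_sideZeros_between hk hl hk2 hl2 (by omega) (by have := m.2; omega) hsign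
  choose t ht htz using hex
  have hanti : StrictAnti t := by
    intro m n hmn
    have hmn' : m.1 < n.1 := hmn
    have hn := n.2
    have h1 := (ht n).2
    have h2 := (ht m).1
    have h3 : sampleHeight l (n + 1) ≤ sampleHeight l (m + 1 + 1) := by
      rcases (by omega : m.1 + 1 + 1 = n.1 + 1 ∨ m.1 + 1 + 1 < n.1 + 1) with h | h
      · rw [h]
      · exact (sampleHeight_lt (by omega) h (by omega)).le
    linarith
  have hinj : Function.Injective fun m ↦ sideLine (t m) := by
    intro m n hmn
    have h1 : (sideLine (t m)).im = (sideLine (t n)).im := congrArg UpperHalfPlane.im hmn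
    exact hanti.injective (Real.exp_injective h1)
  have h1 := Set.ncard_le_ncard (Set.range_subset_iff.2 htz) hfin
  rwa [Set.ncard_range_of_injective hinj, Nat.card_eq_fintype_card, Fintype.card_fin] at h1

end EisensteinSide

open EisensteinSide

theorem mainTheorem9 :
    ∃ L : ℕ, ∀ (k l : ℕ) (hk : 3 ≤ k) (hl : 3 ≤ l), Even k → Even l → L ≤ l → l ≤ k →
      (sideZeros hk hl).Finite ∧
      ((l ≡ 2 [MOD 6] ∨ l ≡ 4 [MOD 6]) →
        ⌊(l : ℝ) / 6⌋ - 1 ≤ (sideZeroCount hk hl : ℤ)) ∧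
      (l ≡ 0 [MOD 6] →
        ⌊(l : ℝ) / 6⌋ - 2 ≤ (sideZeroCount hk hl : ℤ)) := by
  obtain ⟨L, hL8, hL⟩ := exists_sign_mul_delta_pos
  refine ⟨L, fun k l hk hl hk2 hl2 hLl hlk ↦ ?_⟩
  have hsign := hL k l hk hl hk2 hLl hlk
  have hne : eisensteinDelta hk hl (sideLine (sampleHeight l 1)) ≠ 0 := fun h0 ↦ by
    have := hsign _ _ _ _ (isSamplePoint_sideLine hl2 le_rfl (by omega : 6 * 1 + 2 ≤ l))
    simp [h0] at this
  have hfin := finite_sideZeros hk hl hne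
  have hcount := le_ncard_sideZeros hk hl hk2 hl2 hfin hsign
  have hfloor : ⌊(l : ℝ) / 6⌋ = ((l / 6 : ℕ) : ℤ) := by
    rw [← Int.natCast_floor_eq_floor (by positivity), Nat.floor_div_ofNat, Nat.floor_natCast]
  rw [hfloor, sideZeroCount]
  simp only [Nat.ModEq]
  refine ⟨hfin, fun h ↦ ?_, fun h ↦ ?_⟩ <;> omega
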